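/- Let $\Sigma$ be a triangulated $2$-sphere on a finite vertex set $V$: a finite connected simplicial complex of dimension $2$ in which the link of every vertex is a cycle and whose Euler characteristic is $f_0-f_1+f_2=2$ (equivalently, a finite simplicial complex whose geometric realization is homeomorphic to $S^2$). Assign coordinates $p_v\in\mathbb{R}^3$ to the vertices $v \in V$ so that the realization is proper, i.e. the coordinates of the vertices of every $k$-face, $0\le k\le 2$, linearly span a subspace of dimension $k+1$. No further embedding condition is imposed. Let $\mathbb{R}[\Sigma]=\mathbb{R}[x_v : v\in V]/\langle x^{a} : \operatorname{supp}(a)\notin\Sigma\rangle$ be the face ring of $\Sigma$, let $\Theta=(\theta_1,\theta_2,\theta_3)$ with $\theta_i=\sum_{v}(p_v)_i\,x_v$, and let $\mathcal{A}^*(\Sigma)=\mathbb{R}[\Sigma]/\Theta\mathbb{R}[\Sigma]$, graded by degree. Suppose that $\Sigma$ with these coordinates is an unstable blueprint: there is no $\ell\in\mathcal{A}^1(\Sigma)$ for which multiplication by $\ell$ is an isomorphism $\mathcal{A}^1(\Sigma)\to\mathcal{A}^2(\Sigma)$. Then $\Sigma$ contains a dividing equator: there are a simple cycle in the $1$-skeleton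 of $\Sigma$ and a linear hyperplane $H\subset\mathbb{R}^3$ (a linear subspace of dimension $2$) such that $p_v\in H$ for every vertex $v$ of the cycle. -/

import Mathlib

open MvPolynomial

noncomputable section

namespace UnstableBlueprint

section Complexes

variable {V : Type*}

/-- The nonface ideal of a complex `K` on the ground set `V`, generated by all monomials whose
support is not a face. The empty set counts as a face, although Mathlib's complexes do not list it,
so only monomials with nonempty support are taken. -/
def nonfaceIdeal (K : AbstractSimplicialComplex V) : Ideal (MvPolynomial V ℝ) :=
  Ideal.span {f | ∃ a : V →₀ ℕ, a.support.Nonempty ∧ a.support ∉ K ∧ f = monomial a 1}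

/-- The face ring `ℝ[K]`. -/
abbrev FaceRing (K : AbstractSimplicialComplex V) : Type _ :=
  MvPolynomial V ℝ ⧸ nonfaceIdeal K

/-- The linear forms `Θ = V x` given by the coordinates `p v ∈ ℝ^d` of the vertices: the `i`-th
form is `∑ v, (p v)ᵢ x_v`. -/
def linearForm [Fintype V] {d : ℕ} (p : V → Fin d → ℝ) (i : Fin d) : MvPolynomial V ℝ :=
  ∑ v, C (p v i) * X v

/-- The ideal `Θ ℝ[K]` of the face ring. -/
def thetaIdeal [Fintype V] (K : AbstractSimplicialComplex V) {d : ℕ} (p : V → Fin d → ℝ) :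
    Ideal (FaceRing K) :=
  Ideal.span (Set.range fun i => Ideal.Quotient.mk (nonfaceIdeal K) (linearForm p i))

/-- The ring `𝒜(K) = ℝ[K] / Θ ℝ[K]`. -/
abbrev ArtinianReduction [Fintype V] (K : AbstractSimplicialComplex V) {d : ℕ}
    (p : V → Fin d → ℝ) : Type _ :=
  FaceRing K ⧸ thetaIdeal K p

/-- The canonical projection `ℝ[x] → ℝ[K] → 𝒜(K)`. -/
def toArtinianReduction [Fintype V] (K : AbstractSimplicialComplex V) {d : ℕ}
    (p : V → Fin d → ℝ) : MvPolynomial V ℝ →ₐ[ℝ] ArtinianReduction K p :=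
  (Ideal.Quotient.mkₐ ℝ (thetaIdeal K p)).comp (Ideal.Quotient.mkₐ ℝ (nonfaceIdeal K))

/-- The graded piece `𝒜ᵏ(K)`: the classes of homogeneous polynomials of degree `k`. -/
def gradedPiece [Fintype V] (K : AbstractSimplicialComplex V) {d : ℕ} (p : V → Fin d → ℝ)
    (k : ℕ) : Submodule ℝ (ArtinianReduction K p) :=
  (homogeneousSubmodule V ℝ k).map (toArtinianReduction K p).toLinearMap

/-- The Lefschetz property with respect to `k`, where `2 k ≤ d`: for some `ℓ ∈ 𝒜¹(K)`,
multiplication by `ℓ ^ (d - 2 k)` is an isomorphism `𝒜ᵏ(K) → 𝒜^{d - k}(K)`. -/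
def HasLefschetzProperty [Fintype V] (K : AbstractSimplicialComplex V) {d : ℕ}
    (p : V → Fin d → ℝ) (k : ℕ) : Prop :=
  ∃ ℓ ∈ gradedPiece K p 1,
    Set.BijOn (fun a => ℓ ^ (d - 2 * k) * a) (gradedPiece K p k) (gradedPiece K p (d - k))

/-- Coordinates in `ℝ^d` are proper if every `k`-face with `k < d` (that is, every face with
`k + 1 ≤ d` vertices) linearly spans a subspace of dimension `k + 1`. -/
def IsProper (K : AbstractSimplicialComplex V) {d : ℕ} (p : V → Fin d → ℝ) : Prop :=
  ∀ s ∈ K, s.card ≤ d → Module.finrank ℝ (Submodule.span ℝ (p '' (s : Set V))) = s.card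

/-- The 1-skeleton, as a graph on the vertices. -/
def oneSkeleton [DecidableEq V] (K : AbstractSimplicialComplex V) : SimpleGraph V where
  Adj u v := u ≠ v ∧ ({u, v} : Finset V) ∈ K
  symm := ⟨fun u v h => ⟨h.1.symm, by rw [Finset.pair_comm]; exact h.2⟩⟩
  loopless := ⟨fun _ h => h.1 rfl⟩

/-- The link of the vertex `v` in a complex of dimension at most 2: its vertices are the
neighbours of `v`, its edges the pairs that form a triangle with `v`. -/
def linkGraph [DecidableEq V] (K : AbstractSimplicialComplex V) (v : V) :
    SimpleGraph {u : V // (oneSkeleton K).Adj v u} where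
  Adj a b := a ≠ b ∧ ({v, a.1, b.1} : Finset V) ∈ K
  symm := ⟨fun a b h => ⟨h.1.symm, by rw [Finset.pair_comm]; exact h.2⟩⟩
  loopless := ⟨fun _ h => h.1 rfl⟩

/-- The number of faces with `m` vertices, that is, of dimension `m - 1`. -/
def faceCount (K : AbstractSimplicialComplex V) (m : ℕ) : ℕ :=
  {s : Finset V | s ∈ K ∧ s.card = m}.ncard

/-- Triangulated 2-spheres: connected closed triangulated surfaces (complexes of dimension at most
2 in which the link of every vertex is a cycle) of Euler characteristic 2. -/
structure IsTriangulatedTwoSphere [Fintype V] [DecidableEq V]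
    (K : AbstractSimplicialComplex V) : Prop where
  card_le : ∀ s ∈ K, s.card ≤ 3
  link_cycle : ∀ v : V, ∃ m : ℕ, 3 ≤ m ∧ Nonempty (linkGraph K v ≃g SimpleGraph.cycleGraph m)
  connected : (oneSkeleton K).Connected
  euler : (faceCount K 1 : ℤ) - faceCount K 2 + faceCount K 3 = 2

/-- An unstable blueprint: a properly realized triangulated 2-sphere in `ℝ³` without the Lefschetz
property with respect to `k = 1`. -/
structure IsUnstableBlueprint [Fintype V] [DecidableEq V] (K : AbstractSimplicialComplex V)
    (p : V → Fin 3 → ℝ) : Prop where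
  sphere : IsTriangulatedTwoSphere K
  proper : IsProper K p
  not_lefschetz : ¬ HasLefschetzProperty K p 1

/-- A dividing equator: a simple cycle in the 1-skeleton that lies in a linear hyperplane. -/
def HasDividingEquator [DecidableEq V] (K : AbstractSimplicialComplex V)
    (p : V → Fin 3 → ℝ) : Prop :=
  ∃ (v : V) (c : (oneSkeleton K).Walk v v), c.IsCycle ∧
    ∃ H : Submodule ℝ (Fin 3 → ℝ), Module.finrank ℝ H = 2 ∧ ∀ u ∈ c.support, p u ∈ H

end Complexes

end UnstableBlueprint

end

/-!
Multiplication by an element of degree 1 from `𝒜¹` to `𝒜²` is understood through its dual. A linear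
functional on `𝒜²` is the same thing as a self-stress: symmetric weights on the edges and vertices
of the sphere for which the points `p x` are in equilibrium at every vertex. If the functional
vanishes on the multiples of `∑ ℓ_x x_x`, its stress stays in equilibrium after the vertices are
lifted to `ℝ⁴` by the heights `ℓ_x`. So the heart of the proof is to find, when there is no dividing
equator, heights that destroy every nonzero self-stress (`exists_lift_sphere`). Then multiplication
is onto, and it is injective by a dimension count: Euler's relation gives `f₁ = 3 f₀ - 6`, so there
are at least `f₀ - 3` independent self-stresses (`card_le_finrank_selfStress`), and the lift maps
them injectively into the space of linear relations among the `p x`, of dimension `f₀ - 3`. Hence it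
maps them onto that space, and a linear form whose product with `∑ ℓ_x x_x` is zero is orthogonal to
all relations, that is, a combination of the parameters `Θ`.

The lift is built by induction for disks in the sphere (`Disk.exists_lift`). A disk is bounded by a
path and an edge `vw` closing it; equilibrium for `p` is required off `v` and `w`, equilibrium for
`ℓ` only at the vertices off the path. Unless the disk is empty its boundary is a simple cycle,
which does not lie in a plane, so the path bends at some inner vertex `q`: the points of `q` and of
its two neighbours on the path are linearly independent (`Disk.exists_bend`).

* If `q` is joined inside the disk to a further vertex of the path, this chord cuts the disk into
  two disks (`Disk.split`), the second of which is rooted at the chord. Lifts of the two parts agree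
  on the chord after adding a linear form to one of them, which changes no equilibrium condition
  (`exists_stressSpace_union_eq_bot`).
* Otherwise removing the star of `q` leaves a disk (`Disk.remove_star`). With `ℓ_q` tending to
  infinity, the conditions at the neighbours of `q` inside the disk force the weights of their edges
  to `q` to vanish; the equilibrium at `q` then only involves `q` and its two neighbours on the
  path, so all weights at `q` vanish by independence (`exists_stressSpace_update_eq_bot`).

Disks are encoded by chains of triangles with coefficients in `ℤ/2`. In place of the Jordan curve
theorem there is the vanishing of the first homology modulo 2 (`exists_boundary_eq_of_cycle`), which
follows from Euler characteristic 2 by counting dimensions.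
-/

namespace UnstableBlueprint

/-! ### Triangles and 2-chains modulo 2 -/

section

theorem mem_of_subset {V : Type*} {K : AbstractSimplicialComplex V} {s t : Finset V} (hs : s ∈ K)
    (hts : t ⊆ s) (ht : t.Nonempty) : t ∈ K :=
  (K.isRelLowerSet_faces hs).2 hts ht

/-- The triangles of `K`, its faces with three vertices. -/
noncomputable def triangles {V : Type*} [Fintype V] (K : AbstractSimplicialComplex V) :
    Finset (Finset V) := by
  classical exact Finset.univ.filter fun t => t ∈ K ∧ t.card = 3

theorem mem_triangles {V : Type*} [Fintype V] {K : AbstractSimplicialComplex V} {t : Finset V} :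
    t ∈ triangles K ↔ t ∈ K ∧ t.card = 3 := by
  simp [triangles]

variable {V : Type*} [Fintype V] [DecidableEq V] {K : AbstractSimplicialComplex V}

theorem adj_of_mem_triangle {t : Finset V} (ht : t ∈ triangles K) {x y : V} (hx : x ∈ t)
    (hy : y ∈ t) (hxy : x ≠ y) : (oneSkeleton K).Adj x y :=
  ⟨hxy, mem_of_subset (mem_triangles.1 ht).1 (by grind) (by simp)⟩

/-- The three vertices of a triangle, given two of them. -/
theorem exists_eq_of_mem_triangle {t : Finset V} (ht : t ∈ triangles K) {x y : V} (hx : x ∈ t)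
    (hy : y ∈ t) (hxy : x ≠ y) : ∃ z, z ≠ x ∧ z ≠ y ∧ t = {x, y, z} := by
  have h3 := (mem_triangles.1 ht).2
  have hsub : ({x, y} : Finset V) ⊆ t := by grind
  obtain ⟨z, hz⟩ := Finset.card_eq_one.1
    (show (t \ {x, y}).card = 1 by rw [Finset.card_sdiff_of_subset hsub, h3, Finset.card_pair hxy])
  have hz' : z ∈ t \ {x, y} := by simp [hz]
  refine ⟨z, by grind, by grind, ?_⟩
  ext u
  have : u ∈ t \ {x, y} ↔ u = z := by simp [hz]
  grind

theorem ne_of_mem_triangles {x y z : V} (h : ({x, y, z} : Finset V) ∈ triangles K) :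
    x ≠ y ∧ x ≠ z ∧ y ≠ z := by
  have h3 := (mem_triangles.1 h).2
  refine ⟨?_, ?_, ?_⟩ <;> rintro rfl
  · have := Finset.card_le_two (a := x) (b := z)
    simp at h3; omega
  · have := Finset.card_le_two (a := x) (b := y)
    rw [Finset.pair_comm y x] at h3
    simp at h3; omega
  · have := Finset.card_le_two (a := x) (b := y)
    simp at h3; omega

/-- Every edge of a triangulated sphere lies in exactly two triangles. -/
theorem IsTriangulatedTwoSphere.exists_two_triangles (hK : IsTriangulatedTwoSphere K) {x y : V}
    (hxy : (oneSkeleton K).Adj x y) : ∃ a b, a ≠ b ∧ ({x, y, a} : Finset V) ∈ triangles K ∧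
      ({x, y, b} : Finset V) ∈ triangles K ∧
      ∀ t ∈ triangles K, x ∈ t → y ∈ t → t = {x, y, a} ∨ t = {x, y, b} := by
  obtain ⟨m, hm, ⟨φ⟩⟩ := hK.link_cycle x
  obtain ⟨n, rfl⟩ : ∃ n, m = n + 3 := ⟨m - 3, by omega⟩
  set c := φ ⟨y, hxy⟩ with hc
  have hadj : ∀ u : {u : V // (oneSkeleton K).Adj x u},
      (linkGraph K x).Adj ⟨y, hxy⟩ u ↔ φ u = c - 1 ∨ φ u = c + 1 := by
    intro u
    rw [← φ.map_adj_iff, ← SimpleGraph.mem_neighborSet, ← hc]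
    rw [SimpleGraph.cycleGraph_neighborSet (n := n + 1)]
    simp
  have hne : c - 1 ≠ c + 1 := by
    intro h
    have h2 : (1 + 1 : Fin (n + 3)) = 0 := by
      have : c - 1 + 1 - c = c + 1 + 1 - c := by rw [h]
      simp at this
      rw [add_assoc, add_sub_cancel_left] at this
      exact this.symm
    have := congrArg Fin.val h2
    rw [Fin.val_add, Fin.val_one, Nat.mod_eq_of_lt (by omega)] at this
    simp at this
  have ha := (hadj (φ.symm (c - 1))).2 (by simp)
  have hb := (hadj (φ.symm (c + 1))).2 (by simp)
  have key : ∀ u : {u : V // (oneSkeleton K).Adj x u}, (linkGraph K x).Adj ⟨y, hxy⟩ u →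
      ({x, y, u.1} : Finset V) ∈ triangles K := by
    intro u hu
    have h1 : y ≠ u.1 := fun h => hu.1 (Subtype.ext h)
    refine mem_triangles.2 ⟨hu.2, ?_⟩
    rw [Finset.card_eq_three]
    exact ⟨x, y, u.1, hxy.1, u.2.1, h1, rfl⟩
  refine ⟨(φ.symm (c - 1)).1, (φ.symm (c + 1)).1, ?_, key _ ha, key _ hb, ?_⟩
  · intro h
    exact hne (φ.symm.injective (Subtype.ext h))
  · intro t ht hx hy
    obtain ⟨z, hzx, hzy, rfl⟩ := exists_eq_of_mem_triangle ht hx hy hxy.1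
    have hz : (oneSkeleton K).Adj x z := adj_of_mem_triangle ht (by simp) (by simp) hzx.symm
    have := (hadj ⟨z, hz⟩).1 ⟨fun h => hzy (congrArg Subtype.val h).symm, (mem_triangles.1 ht).1⟩
    rcases this with h | h
    · left; rw [← h]; simp
    · right; rw [← h]; simp

/-- The simplicial boundary of a 2-chain with coefficients in `ℤ/2`, as a function on edges. -/
noncomputable def boundary (K : AbstractSimplicialComplex V) (f : Finset V → ZMod 2)
    (s : Finset V) : ZMod 2 :=
  ∑ t ∈ triangles K with s ⊆ t, f t

theorem boundary_add (f g : Finset V → ZMod 2) (s : Finset V) :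
    boundary K (f + g) s = boundary K f s + boundary K g s :=
  Finset.sum_add_distrib

theorem boundary_congr {f g : Finset V → ZMod 2} (h : ∀ t ∈ triangles K, f t = g t)
    (s : Finset V) : boundary K f s = boundary K g s :=
  Finset.sum_congr rfl fun t ht => h t (Finset.mem_filter.1 ht).1

theorem exists_of_boundary_ne_zero {f : Finset V → ZMod 2} {s : Finset V}
    (h : boundary K f s ≠ 0) : ∃ t ∈ triangles K, s ⊆ t ∧ f t = 1 := by
  obtain ⟨t, ht, hft⟩ := Finset.exists_ne_zero_of_sum_ne_zero h
  rw [Finset.mem_filter] at ht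
  exact ⟨t, ht.1, ht.2, by generalize f t = e at hft; revert hft; revert e; decide⟩

/-- The boundary of a chain at an edge is the sum of its values on the two triangles there. -/
theorem IsTriangulatedTwoSphere.exists_boundary_eq (hK : IsTriangulatedTwoSphere K) {x y : V}
    (hxy : (oneSkeleton K).Adj x y) : ∃ t₁ ∈ triangles K, ∃ t₂ ∈ triangles K, t₁ ≠ t₂ ∧
      x ∈ t₁ ∧ y ∈ t₁ ∧ x ∈ t₂ ∧ y ∈ t₂ ∧
      (∀ t ∈ triangles K, x ∈ t → y ∈ t → t = t₁ ∨ t = t₂) ∧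
      ∀ f, boundary K f {x, y} = f t₁ + f t₂ := by
  obtain ⟨a, b, hab, ha, hb, h⟩ := hK.exists_two_triangles hxy
  have hne : ({x, y, a} : Finset V) ≠ {x, y, b} := by
    intro h
    have h1 := ne_of_mem_triangles ha
    have : a ∈ ({x, y, b} : Finset V) := by rw [← h]; simp
    grind
  refine ⟨_, ha, _, hb, hne, by simp, by simp, by simp, by simp, h, fun f => ?_⟩
  have : (triangles K).filter (fun t => ({x, y} : Finset V) ⊆ t) =
      {({x, y, a} : Finset V), {x, y, b}} := by
    ext t
    simp only [Finset.mem_filter, Finset.mem_insert, Finset.mem_singleton]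
    constructor
    · rintro ⟨ht, hs⟩
      exact h t ht (hs (by simp)) (hs (by simp))
    · rintro (rfl | rfl)
      · exact ⟨ha, by grind⟩
      · exact ⟨hb, by grind⟩
  rw [boundary, this, Finset.sum_pair hne]

/-- A chain whose boundary vanishes at all edges through `x` is constant on the star of `x`,
because the link of `x` is connected. -/
theorem IsTriangulatedTwoSphere.eq_of_mem_star (hK : IsTriangulatedTwoSphere K)
    {f : Finset V → ZMod 2} {x : V} (hf : ∀ y, (oneSkeleton K).Adj x y → boundary K f {x, y} = 0)
    {s t : Finset V} (hs : s ∈ triangles K) (ht : t ∈ triangles K) (hxs : x ∈ s) (hxt : x ∈ t) :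
    f s = f t := by
  have pair : ∀ y, (oneSkeleton K).Adj x y → ∀ s ∈ triangles K, ∀ t ∈ triangles K,
      x ∈ s → y ∈ s → x ∈ t → y ∈ t → f s = f t := by
    intro y hy s hs t ht hxs hys hxt hyt
    obtain ⟨t₁, -, t₂, -, -, -, -, -, -, h, hb⟩ := hK.exists_boundary_eq hy
    have h0 := hb f
    rw [hf y hy] at h0
    have h1 : f t₁ = f t₂ := (CharTwo.add_eq_zero.1 h0.symm)
    rcases h s hs hxs hys with rfl | rfl <;> rcases h t ht hxt hyt with rfl | rfl <;> simp [h1]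
  have other : ∀ t ∈ triangles K, x ∈ t → ∃ y, y ∈ t ∧ (oneSkeleton K).Adj x y := by
    intro t ht hx
    obtain ⟨y, hy, hne⟩ := Finset.exists_mem_ne (by rw [(mem_triangles.1 ht).2]; norm_num) x
    exact ⟨y, hy, adj_of_mem_triangle ht hx hy hne.symm⟩
  obtain ⟨a, has, ha⟩ := other s hs hxs
  obtain ⟨b, hbt, hb⟩ := other t ht hxt
  obtain ⟨m, hm, ⟨φ⟩⟩ := hK.link_cycle x
  obtain ⟨n, rfl⟩ : ∃ n, m = n + 3 := ⟨m - 3, by omega⟩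
  have hconn : (linkGraph K x).Connected :=
    (φ.connected_iff).2 SimpleGraph.cycleGraph_connected
  obtain ⟨p⟩ := hconn.preconnected ⟨a, ha⟩ ⟨b, hb⟩
  have walk : ∀ (u u' : {u : V // (oneSkeleton K).Adj x u}) (_ : (linkGraph K x).Walk u u'),
      ∀ s ∈ triangles K, ∀ t ∈ triangles K, x ∈ s → u.1 ∈ s → x ∈ t → u'.1 ∈ t → f s = f t := by
    intro u u' p
    induction p with
    | nil => exact pair _ (Subtype.property _)
    | @cons u c u' h p ih =>
      intro s hs t ht hxs hus hxt hut
      have hT : ({x, u.1, c.1} : Finset V) ∈ triangles K := by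
        refine mem_triangles.2 ⟨h.2, Finset.card_eq_three.2 ⟨x, u.1, c.1, u.2.1, c.2.1, ?_, rfl⟩⟩
        exact fun h' => h.1 (Subtype.ext h')
      exact (pair _ u.2 s hs _ hT hxs hus (by simp) (by simp)).trans
        (ih _ hT t ht (by simp) (by simp) hxt hut)
  exact walk _ _ p s hs t ht hxs has hxt hbt

/-- A 2-cycle modulo 2 is constant: the second homology is one-dimensional. -/
theorem IsTriangulatedTwoSphere.eq_of_boundary_eq_zero (hK : IsTriangulatedTwoSphere K)
    {f : Finset V → ZMod 2} (hf : ∀ x y, (oneSkeleton K).Adj x y → boundary K f {x, y} = 0)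
    {s t : Finset V} (hs : s ∈ triangles K) (ht : t ∈ triangles K) : f s = f t := by
  obtain ⟨a, ha⟩ := Finset.card_pos.1 (by rw [(mem_triangles.1 hs).2]; norm_num : 0 < s.card)
  obtain ⟨b, hb⟩ := Finset.card_pos.1 (by rw [(mem_triangles.1 ht).2]; norm_num : 0 < t.card)
  obtain ⟨p⟩ := hK.connected.preconnected a b
  induction p generalizing s with
  | nil => exact hK.eq_of_mem_star (hf _) hs ht ha hb
  | cons h p ih =>
    obtain ⟨c, -, -, hc, -⟩ := hK.exists_two_triangles h
    exact (hK.eq_of_mem_star (hf _) hs hc ha (by simp)).trans (ih hc (by simp) hb)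

/-- The boundary of a boundary is zero. -/
theorem sum_boundary_eq_zero (f : Finset V → ZMod 2) (x : V) :
    ∑ y ∈ Finset.univ.erase x, boundary K f {x, y} = 0 := by
  simp only [boundary, Finset.sum_filter]
  rw [Finset.sum_comm]
  refine Finset.sum_eq_zero fun t ht => ?_
  rw [← Finset.sum_filter, Finset.sum_const]
  by_cases hx : x ∈ t
  · have : (Finset.univ.erase x).filter (fun y => ({x, y} : Finset V) ⊆ t) = t.erase x := by
      ext y; simp [Finset.insert_subset_iff, hx]
    rw [this, Finset.card_erase_of_mem hx, (mem_triangles.1 ht).2]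
    exact CharTwo.two_nsmul _
  · have : (Finset.univ.erase x).filter (fun y => ({x, y} : Finset V) ⊆ t) = ∅ := by
      ext y; simp [Finset.insert_subset_iff, hx]
    simp [this]

end

/-! ### Vanishing of the first homology modulo 2 -/

section

/-- The edges of `K`, its faces with two vertices. -/
noncomputable def edges {V : Type*} [Fintype V] (K : AbstractSimplicialComplex V) :
    Finset (Finset V) := by
  classical exact Finset.univ.filter fun s => s ∈ K ∧ s.card = 2

theorem mem_edges {V : Type*} [Fintype V] {K : AbstractSimplicialComplex V} {s : Finset V} :
    s ∈ edges K ↔ s ∈ K ∧ s.card = 2 := by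
  simp [edges]

variable {V : Type*} [Fintype V] [DecidableEq V] {K : AbstractSimplicialComplex V}

theorem pair_mem_edges {x y : V} : ({x, y} : Finset V) ∈ edges K ↔ (oneSkeleton K).Adj x y := by
  rw [mem_edges]
  constructor
  · rintro ⟨h, h2⟩
    exact ⟨fun h => by simp [h] at h2, h⟩
  · rintro ⟨h, h2⟩
    exact ⟨h2, Finset.card_pair h⟩

theorem exists_adj_of_mem_edges {s : Finset V} (hs : s ∈ edges K) :
    ∃ x y, (oneSkeleton K).Adj x y ∧ s = {x, y} := by
  obtain ⟨x, y, -, rfl⟩ := Finset.card_eq_two.1 (mem_edges.1 hs).2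
  exact ⟨x, y, pair_mem_edges.1 hs, rfl⟩

theorem boundary_eq_zero_of_not_mem {f : Finset V → ZMod 2} {s : Finset V} (hs : s.Nonempty)
    (h : s ∉ K) : boundary K f s = 0 := by
  by_contra h0
  obtain ⟨t, ht, hst, -⟩ := exists_of_boundary_ne_zero h0
  exact h (mem_of_subset (mem_triangles.1 ht).1 hst hs)

theorem IsTriangulatedTwoSphere.two_mul_card_edges (hK : IsTriangulatedTwoSphere K) :
    2 * (edges K).card = 3 * (triangles K).card := by
  have h := Finset.sum_card_bipartiteAbove_eq_sum_card_bipartiteBelow (s := edges K)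
    (t := triangles K) (fun s t => s ⊆ t)
  rw [Finset.sum_congr rfl (g := fun _ => 2), Finset.sum_congr rfl (s₁ := triangles K)
    (g := fun _ => 3)] at h
  · simpa [mul_comm] using h
  · intro t ht
    have : (edges K).bipartiteBelow (fun s t => s ⊆ t) t = t.powersetCard 2 := by
      ext s
      simp only [Finset.mem_bipartiteBelow, Finset.mem_powersetCard, mem_edges]
      constructor
      · rintro ⟨⟨-, h2⟩, h⟩; exact ⟨h, h2⟩
      · rintro ⟨h, h2⟩
        exact ⟨⟨mem_of_subset (mem_triangles.1 ht).1 h (Finset.card_pos.1 (by omega)), h2⟩, h⟩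
    rw [this, Finset.card_powersetCard, (mem_triangles.1 ht).2]
    rfl
  · intro s hs
    obtain ⟨x, y, hxy, rfl⟩ := exists_adj_of_mem_edges hs
    obtain ⟨t₁, h₁, t₂, h₂, hne, hx1, hy1, hx2, hy2, hall, -⟩ := hK.exists_boundary_eq hxy
    have : (triangles K).bipartiteAbove (fun s t => s ⊆ t) {x, y} = {t₁, t₂} := by
      ext t
      simp only [Finset.mem_bipartiteAbove, Finset.mem_insert, Finset.mem_singleton]
      constructor
      · rintro ⟨ht, hs⟩
        exact hall t ht (hs (by simp)) (hs (by simp))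
      · rintro (rfl | rfl)
        · exact ⟨h₁, by grind⟩
        · exact ⟨h₂, by grind⟩
    rw [this, Finset.card_pair hne]

theorem IsTriangulatedTwoSphere.card_edges (hK : IsTriangulatedTwoSphere K) :
    (edges K).card + 6 = 3 * Fintype.card V ∧ (triangles K).card + 4 = 2 * Fintype.card V := by
  have h1 : faceCount K 1 = Fintype.card V := by
    have : {s : Finset V | s ∈ K ∧ s.card = 1} = Set.range (fun v : V => ({v} : Finset V)) := by
      ext s
      simp only [Set.mem_ofPred_eq, Finset.card_eq_one, Set.mem_range]
      constructor
      · rintro ⟨-, a, rfl⟩; exact ⟨a, rfl⟩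
      · rintro ⟨a, rfl⟩; exact ⟨K.singleton_mem a, a, rfl⟩
    rw [faceCount, this, ← Set.image_univ,
      Set.ncard_image_of_injective _ Finset.singleton_injective, Set.ncard_univ,
      Nat.card_eq_fintype_card]
  have h2 : faceCount K 2 = (edges K).card := by
    rw [faceCount, ← Set.ncard_coe_finset]
    congr 1; ext s; simp [mem_edges]
  have h3 : faceCount K 3 = (triangles K).card := by
    rw [faceCount, ← Set.ncard_coe_finset]
    congr 1; ext s; simp [mem_triangles]
  have := hK.euler
  rw [h1, h2, h3] at this
  have := hK.two_mul_card_edges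
  omega

theorem sum_edges_eq {M : Type*} [AddCommMonoid M] (g : Finset V → M)
    (hg : ∀ x y, x ≠ y → ({x, y} : Finset V) ∉ K → g {x, y} = 0) (x : V) :
    ∑ s ∈ edges K with x ∈ s, g s = ∑ y ∈ Finset.univ.erase x, g {x, y} := by
  have : ∑ y ∈ Finset.univ.erase x, g {x, y} =
      ∑ y ∈ (Finset.univ.erase x).filter (fun y => ({x, y} : Finset V) ∈ edges K), g {x, y} := by
    refine (Finset.sum_filter_of_ne fun y hy h => ?_).symm
    by_contra h'
    have hne := (Finset.ne_of_mem_erase hy).symm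
    exact h (hg x y hne fun h2 => h' (pair_mem_edges.2 ⟨hne, h2⟩))
  rw [this]
  refine (Finset.sum_bij (fun y _ => ({x, y} : Finset V)) ?_ ?_ ?_ ?_).symm
  · intro y hy
    simp only [Finset.mem_filter] at hy ⊢
    exact ⟨hy.2, by simp⟩
  · intro y hy z hz h
    simp only [Finset.mem_filter, Finset.mem_erase] at hy hz
    have : y ∈ ({x, z} : Finset V) := by rw [← h]; simp
    grind
  · intro s hs
    rw [Finset.mem_filter] at hs
    obtain ⟨a, b, hab, rfl⟩ := exists_adj_of_mem_edges hs.1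
    have hx : x = a ∨ x = b := by simpa using hs.2
    rcases hx with rfl | rfl
    · exact ⟨b, by simp [hab.1.symm, hs.1], rfl⟩
    · exact ⟨a, by simp [hab.1, Finset.pair_comm x a, hs.1], Finset.pair_comm _ _⟩
  · intros; rfl

/-- The first homology modulo 2 of a triangulated sphere vanishes. The second homology and the
zeroth are one-dimensional, so this is the Euler characteristic being 2. -/
theorem IsTriangulatedTwoSphere.exists_boundary_eq_of_cycle (hK : IsTriangulatedTwoSphere K)
    (z : Finset V → ZMod 2) (hz : ∀ x y, x ≠ y → ({x, y} : Finset V) ∉ K → z {x, y} = 0)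
    (hcyc : ∀ x, ∑ y ∈ Finset.univ.erase x, z {x, y} = 0) :
    ∃ f, ∀ x y, x ≠ y → boundary K f {x, y} = z {x, y} := by
  obtain ⟨A, hAx⟩ : ∃ A : Matrix V (edges K) (ZMod 2),
      ∀ x s, A x s = if x ∈ s.1 then 1 else 0 := ⟨fun _ _ => _, fun _ _ => rfl⟩
  obtain ⟨B, hBx⟩ : ∃ B : Matrix (edges K) (triangles K) (ZMod 2),
      ∀ s t, B s t = if s.1 ⊆ t.1 then 1 else 0 := ⟨fun _ _ => _, fun _ _ => rfl⟩
  have hA : ∀ g : Finset V → ZMod 2, ∀ x,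
      A.mulVecLin (fun s => g s.1) x = ∑ s ∈ edges K with x ∈ s, g s := by
    intro g x
    rw [Finset.sum_filter, ← Finset.sum_coe_sort]
    simp [Matrix.mulVec, dotProduct, hAx]
  have hB : ∀ f : Finset V → ZMod 2, ∀ s : edges K,
      B.mulVecLin (fun t => f t.1) s = boundary K f s.1 := by
    intro f s
    rw [boundary, Finset.sum_filter, ← Finset.sum_coe_sort]
    simp [Matrix.mulVec, dotProduct, hBx]
  have ext : ∀ f : triangles K → ZMod 2, ∃ f' : Finset V → ZMod 2, (fun t => f' t.1) = f := by
    intro f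
    exact ⟨fun t => if h : t ∈ triangles K then f ⟨t, h⟩ else 0, by ext t; simp⟩
  -- the kernel of `B`, the 2-cycles, consists of the constant chains
  have kerB : Module.finrank (ZMod 2) (LinearMap.ker B.mulVecLin) ≤ 1 := by
    refine finrank_le_one (⟨fun _ => 1, ?_⟩ : LinearMap.ker B.mulVecLin) ?_
    · rw [LinearMap.mem_ker]
      ext s
      rw [hB (fun _ => 1)]
      obtain ⟨x, y, hxy, hs⟩ := exists_adj_of_mem_edges s.2
      obtain ⟨t₁, -, t₂, -, -, -, -, -, -, -, h⟩ := hK.exists_boundary_eq hxy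
      rw [hs, h]
      exact CharTwo.add_self_eq_zero _
    · rintro ⟨f, hf⟩
      obtain ⟨f', rfl⟩ := ext f
      have hconst : ∀ s ∈ triangles K, ∀ t ∈ triangles K, f' s = f' t := fun s hs t ht =>
        hK.eq_of_boundary_eq_zero (fun x y h => by
          rw [← hB f' ⟨_, pair_mem_edges.2 h⟩, LinearMap.mem_ker.1 hf]; rfl) hs ht
      rcases (triangles K).eq_empty_or_nonempty with h | ⟨t₀, h₀⟩
      · refine ⟨0, ?_⟩
        ext t
        exact absurd t.2 (by simp [h])
      · refine ⟨f' t₀, ?_⟩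
        ext t
        simp [hconst t₀ h₀ t.1 t.2]
  -- the kernel of the transpose of `A` consists of the constant functions on the vertices
  have kerA : Module.finrank (ZMod 2) (LinearMap.ker A.transpose.mulVecLin) ≤ 1 := by
    have hAt : ∀ (g : V → ZMod 2) (x y) (h : (oneSkeleton K).Adj x y),
        A.transpose.mulVecLin g ⟨{x, y}, pair_mem_edges.2 h⟩ = g x + g y := by
      intro g x y h
      simp only [Matrix.mulVecLin_apply, Matrix.mulVec, dotProduct, Matrix.transpose_apply,
        hAx, ite_mul, one_mul, zero_mul]
      rw [← Finset.sum_filter, Finset.filter_mem_eq_inter, Finset.univ_inter, Finset.sum_pair h.1]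
    obtain ⟨x₀⟩ := hK.connected.nonempty
    refine finrank_le_one (⟨fun _ => 1, ?_⟩ : LinearMap.ker A.transpose.mulVecLin) ?_
    · rw [LinearMap.mem_ker]
      ext ⟨s, hs⟩
      obtain ⟨x, y, hxy, rfl⟩ := exists_adj_of_mem_edges hs
      rw [hAt _ _ _ hxy]
      exact CharTwo.add_self_eq_zero _
    · rintro ⟨g, hg⟩
      have hadj : ∀ x y, (oneSkeleton K).Adj x y → g x = g y := by
        intro x y h
        rw [← CharTwo.add_eq_zero, ← hAt g x y h, LinearMap.mem_ker.1 hg]; rfl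
      have hconst : ∀ x, g x₀ = g x := by
        intro x
        obtain ⟨p⟩ := hK.connected.preconnected x₀ x
        induction p with
        | nil => rfl
        | cons h _ ih => exact (hadj _ _ h).trans ih
      refine ⟨g x₀, ?_⟩
      ext x
      simp [hconst x]
  have rA := A.transpose.mulVecLin.finrank_range_add_finrank_ker
  have rA' := A.mulVecLin.finrank_range_add_finrank_ker
  have rB := B.mulVecLin.finrank_range_add_finrank_ker
  have hrank : Module.finrank (ZMod 2) (LinearMap.range A.transpose.mulVecLin) =
      Module.finrank (ZMod 2) (LinearMap.range A.mulVecLin) := A.rank_transpose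
  simp only [Module.finrank_fintype_fun_eq_card, Fintype.card_coe] at rA rA' rB
  have hcard := hK.card_edges
  have hle : LinearMap.range B.mulVecLin ≤ LinearMap.ker A.mulVecLin := by
    rintro _ ⟨f, rfl⟩
    obtain ⟨f', rfl⟩ := ext f
    rw [LinearMap.mem_ker]
    ext x
    have : B.mulVecLin (fun t => f' t.1) = fun s => boundary K f' s.1 := funext (hB f')
    rw [this, hA, sum_edges_eq, sum_boundary_eq_zero]
    · rfl
    · exact fun x y _ h => boundary_eq_zero_of_not_mem (by simp) h
  -- `rank B ≥ f₂ - 1` and `dim ker A ≤ f₁ - (f₀ - 1)` agree by Euler's relation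
  have heq := Submodule.eq_of_le_of_finrank_le hle (by omega)
  have hmem : (fun s : edges K => z s.1) ∈ LinearMap.range B.mulVecLin := by
    rw [heq, LinearMap.mem_ker]
    ext x
    rw [hA, sum_edges_eq z hz, hcyc]
    rfl
  obtain ⟨f, hf⟩ := hmem
  obtain ⟨f', rfl⟩ := ext f
  refine ⟨f', fun x y hxy => ?_⟩
  by_cases h : ({x, y} : Finset V) ∈ K
  · have := congrFun hf ⟨{x, y}, pair_mem_edges.2 ⟨hxy, h⟩⟩
    rwa [hB] at this
  · rw [hz x y hxy h, boundary_eq_zero_of_not_mem (by simp) h]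

end

/-! ### Disks bounded by a closed path -/

section

/-- The sum modulo 2 of the edges of the path through the vertices in the list. -/
def pathChain {V : Type*} [DecidableEq V] : List V → Finset V → ZMod 2
  | x :: y :: r => fun s => (if s = {x, y} then 1 else 0) + pathChain (y :: r) s
  | _ => fun _ => 0

theorem pathChain_cons_cons {V : Type*} [DecidableEq V] (x y : V) (r : List V) (s : Finset V) :
    pathChain (x :: y :: r) s = (if s = {x, y} then 1 else 0) + pathChain (y :: r) s := rfl

theorem pathChain_append {V : Type*} [DecidableEq V] (l : List V) (x : V) (r : List V)
    (s : Finset V) :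
    pathChain (l ++ x :: r) s = pathChain (l ++ [x]) s + pathChain (x :: r) s := by
  induction l with
  | nil => simp [pathChain]
  | cons a l ih =>
    cases l with
    | nil => simp [pathChain]
    | cons b l =>
      simp only [List.cons_append, pathChain_cons_cons] at ih ⊢
      rw [ih, add_assoc]

theorem exists_of_pathChain_ne_zero {V : Type*} [DecidableEq V] {l : List V} {s : Finset V}
    (h : pathChain l s ≠ 0) : ∃ l₁ a b l₂, l = l₁ ++ a :: b :: l₂ ∧ s = {a, b} := by
  induction l with
  | nil => exact absurd rfl h
  | cons x l ih =>
    cases l with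
    | nil => exact absurd rfl h
    | cons y l =>
      rw [pathChain_cons_cons] at h
      by_cases hs : s = {x, y}
      · exact ⟨[], x, y, l, rfl, hs⟩
      · rw [if_neg hs, zero_add] at h
        obtain ⟨l₁, a, b, l₂, h1, h2⟩ := ih h
        exact ⟨x :: l₁, a, b, l₂, by rw [h1]; rfl, h2⟩

theorem pathChain_eq_zero {V : Type*} [DecidableEq V] {l : List V} {s : Finset V} {x : V}
    (hx : x ∈ s) (hl : x ∉ l) : pathChain l s = 0 := by
  by_contra h
  obtain ⟨l₁, a, b, l₂, rfl, rfl⟩ := exists_of_pathChain_ne_zero h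
  grind

theorem pathChain_eq_one {V : Type*} [DecidableEq V] {l₁ l₂ : List V} {a b : V}
    (h : (l₁ ++ a :: b :: l₂).Nodup) : pathChain (l₁ ++ a :: b :: l₂) {a, b} = 1 := by
  rw [pathChain_append, pathChain_cons_cons, if_pos rfl,
    pathChain_eq_zero (x := b) (by simp) (by grind),
    pathChain_eq_zero (x := a) (by simp) (by grind)]
  rfl

variable {V : Type*} [Fintype V] [DecidableEq V] {K : AbstractSimplicialComplex V}

theorem sum_edge_indicator {a b : V} (hab : a ≠ b) (x : V) :
    ∑ y ∈ Finset.univ.erase x, (if ({x, y} : Finset V) = {a, b} then (1 : ZMod 2) else 0) =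
      (if x = a then 1 else 0) + if x = b then 1 else 0 := by
  have aux : ∀ c : V, c ≠ x → ∀ d,
      (∀ y, ({x, y} : Finset V) = {a, b} ↔ y = c ∧ d) → ∀ [Decidable d],
      ∑ y ∈ Finset.univ.erase x, (if ({x, y} : Finset V) = {a, b} then (1 : ZMod 2) else 0) =
      if d then 1 else 0 := by
    intro c hc d h _
    simp only [h]
    by_cases hd : d <;> simp [hd, hc]
  have pair : ∀ y, ({x, y} : Finset V) = {a, b} ↔ (x = a ∧ y = b) ∨ (x = b ∧ y = a) := by
    intro y
    rw [← Finset.coe_inj, Finset.coe_pair, Finset.coe_pair, Set.pair_eq_pair_iff]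
  by_cases hxa : x = a
  · subst hxa
    rw [aux b hab.symm True (fun y => by rw [pair]; grind)]
    simp [hab]
  · by_cases hxb : x = b
    · subst hxb
      rw [aux a hab True (fun y => by rw [pair]; grind)]
      simp [hab.symm]
    · rw [Finset.sum_eq_zero]
      · simp [hxa, hxb]
      · intro y _
        rw [if_neg]
        rw [pair]; grind

/-- The boundary of a path is the sum of its two ends. -/
theorem sum_pathChain {l : List V} (hl : l.Nodup) {v w : V} (hv : l.head? = some v)
    (hw : l.getLast? = some w) (x : V) :
    ∑ y ∈ Finset.univ.erase x, pathChain l {x, y} =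
      (if x = v then 1 else 0) + if x = w then 1 else 0 := by
  induction l generalizing v with
  | nil => simp at hv
  | cons a l ih =>
    cases l with
    | nil =>
      obtain rfl : a = v := by simpa using hv
      obtain rfl : a = w := by simpa using hw
      simp [pathChain, CharTwo.add_self_eq_zero]
    | cons b l =>
      obtain rfl : a = v := by simpa using hv
      simp only [pathChain_cons_cons, Finset.sum_add_distrib]
      rw [ih (List.nodup_cons.1 hl).2 (v := b) (by simp) (by simpa using hw),
        sum_edge_indicator (by grind)]
      linear_combination CharTwo.add_self_eq_zero (if x = b then (1 : ZMod 2) else 0)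

/-- A 1-cycle modulo 2 supported on a simple path vanishes. -/
theorem eq_zero_of_support_path (f : Finset V → ZMod 2)
    (hf : ∀ x, ∑ y ∈ Finset.univ.erase x, f {x, y} = 0) {l : List V} (hl : l.Nodup)
    (h : ∀ x y, x ≠ y → f {x, y} ≠ 0 → pathChain l {x, y} ≠ 0) :
    ∀ x y, x ≠ y → f {x, y} = 0 := by
  induction l with
  | nil =>
    intro x y hxy
    by_contra h0
    exact h x y hxy h0 rfl
  | cons a l ih =>
    cases l with
    | nil =>
      intro x y hxy
      by_contra h0
      exact h x y hxy h0 rfl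
    | cons b l =>
      have hab : a ≠ b := by grind
      have ha : a ∉ b :: l := (List.nodup_cons.1 hl).1
      have h0 : f {a, b} = 0 := by
        rw [← hf a]
        symm
        refine Finset.sum_eq_single b (fun y hy hyb => ?_) (by simp [hab.symm])
        by_contra hne
        have hya := (Finset.ne_of_mem_erase hy).symm
        have := h a y hya hne
        rw [pathChain_cons_cons, pathChain_eq_zero (x := a) (by simp) ha, if_neg] at this
        · exact this (add_zero 0)
        · intro h'
          have : y ∈ ({a, b} : Finset V) := by rw [← h']; simp
          grind
      refine ih (List.nodup_cons.1 hl).2 fun x y hxy hne => ?_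
      have := h x y hxy hne
      rw [pathChain_cons_cons, if_neg, zero_add] at this
      · exact this
      · intro h'
        exact hne (h' ▸ h0)

/-- `Disk K f v w l` says that the triangles in the support of `f` do not exhaust the sphere, and
that their boundary modulo 2 is the closed path that runs through the vertices of the list `l` from
`v` to `w` and returns along the edge `vw`. For `l = [v, w]` the two edges cancel. -/
structure Disk (K : AbstractSimplicialComplex V) (f : Finset V → ZMod 2) (v w : V)
    (l : List V) : Prop where
  head : l.head? = some v
  last : l.getLast? = some w
  nodup : l.Nodup
  ne : v ≠ w
  boundary_eq : ∀ x y, x ≠ y →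
    boundary K f {x, y} = pathChain l {x, y} + if ({x, y} : Finset V) = {v, w} then 1 else 0
  proper : ∃ t ∈ triangles K, f t = 0

/-- The vertices `x` and `y` lie in a common triangle of the support of `f`. -/
def ChainEdge (K : AbstractSimplicialComplex V) (f : Finset V → ZMod 2) (x y : V) : Prop :=
  ∃ t ∈ triangles K, f t = 1 ∧ x ∈ t ∧ y ∈ t

theorem ChainEdge.symm {V : Type*} [Fintype V] {K : AbstractSimplicialComplex V}
    {f : Finset V → ZMod 2} {x y : V} (h : ChainEdge K f x y) : ChainEdge K f y x := by
  obtain ⟨t, ht, h1, hx, hy⟩ := h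
  exact ⟨t, ht, h1, hy, hx⟩

theorem ChainEdge.adj {f : Finset V → ZMod 2} {x y : V} (h : ChainEdge K f x y) (hxy : x ≠ y) :
    (oneSkeleton K).Adj x y := by
  obtain ⟨t, ht, -, hx, hy⟩ := h
  exact adj_of_mem_triangle ht hx hy hxy

theorem chainEdge_of_boundary_eq_one {f : Finset V → ZMod 2} {x y : V}
    (h : boundary K f {x, y} = 1) : ChainEdge K f x y := by
  obtain ⟨t, ht, hs, h1⟩ := exists_of_boundary_ne_zero (h ▸ one_ne_zero)
  exact ⟨t, ht, h1, hs (by simp), hs (by simp)⟩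

namespace Disk

variable {f g : Finset V → ZMod 2} {v w : V} {l : List V}

theorem congr (h : Disk K f v w l) (hfg : ∀ t ∈ triangles K, f t = g t) : Disk K g v w l where
  head := h.head
  last := h.last
  nodup := h.nodup
  ne := h.ne
  boundary_eq x y hxy := by rw [← boundary_congr hfg, h.boundary_eq x y hxy]
  proper := by
    obtain ⟨t, ht, h0⟩ := h.proper
    exact ⟨t, ht, by rw [← hfg t ht, h0]⟩

theorem head_mem (h : Disk K f v w l) : v ∈ l := List.mem_of_head? h.head

theorem last_mem (h : Disk K f v w l) : w ∈ l := List.mem_of_getLast? h.last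

theorem boundary_eq_zero_of_not_mem (h : Disk K f v w l) {x y : V} (hxy : x ≠ y) (hx : x ∉ l) :
    boundary K f {x, y} = 0 := by
  rw [h.boundary_eq x y hxy, pathChain_eq_zero (x := x) (by simp) hx, if_neg, add_zero]
  intro h'
  have : x ∈ ({v, w} : Finset V) := by rw [← h']; simp
  have := h.head_mem
  have := h.last_mem
  grind

/-- At a vertex off the boundary path, either all triangles or none belong to the disk. -/
theorem eq_of_not_mem (hK : IsTriangulatedTwoSphere K) (h : Disk K f v w l) {x : V} (hx : x ∉ l)
    {s t : Finset V} (hs : s ∈ triangles K) (ht : t ∈ triangles K) (hxs : x ∈ s) (hxt : x ∈ t) :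
    f s = f t :=
  hK.eq_of_mem_star (fun _ hy => h.boundary_eq_zero_of_not_mem hy.1 hx) hs ht hxs hxt

theorem eq_nil_of_consecutive {l₁ l₂ : List V} {a b : V}
    (h : Disk K f v w (l₁ ++ a :: b :: l₂)) (hab : ({a, b} : Finset V) = {v, w}) :
    l₁ = [] ∧ l₂ = [] := by
  have hn := h.nodup
  have hh := h.head
  have hl := h.last
  have hab' : (a = v ∧ b = w) ∨ (a = w ∧ b = v) := by
    rwa [← Finset.coe_inj, Finset.coe_pair, Finset.coe_pair, Set.pair_eq_pair_iff] at hab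
  have hl' : (b :: l₂).getLast? = some w := by
    rw [← hl, List.append_cons l₁ a, List.getLast?_append_cons]
  have hwb : w ∈ b :: l₂ := List.mem_of_getLast? hl'
  have hva : v ∈ l₁ ++ [a] := by
    refine List.mem_of_head? ?_
    rw [← hh]; simp [List.head?_append]
  obtain ⟨rfl, rfl⟩ : a = v ∧ b = w := by grind
  constructor
  · cases l₁ with
    | nil => rfl
    | cons c l₁ => simp at hh; subst hh; grind
  · rcases List.eq_nil_or_concat l₂ with rfl | ⟨m, c, rfl⟩
    · rfl
    · rw [List.concat_eq_append, ← List.cons_append, List.getLast?_concat] at hl'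
      obtain rfl : c = b := by simpa using hl'
      grind

theorem boundary_consecutive {l₁ l₂ : List V} {a b : V}
    (h : Disk K f v w (l₁ ++ a :: b :: l₂)) (hne : l₁ ≠ [] ∨ l₂ ≠ []) :
    boundary K f {a, b} = 1 := by
  have hn := h.nodup
  rw [h.boundary_eq a b (by grind), pathChain_eq_one hn, if_neg, add_zero]
  intro h'
  have := h.eq_nil_of_consecutive h'
  grind

theorem boundary_root (h : Disk K f v w l) (hl : 3 ≤ l.length) : boundary K f {v, w} = 1 := by
  rw [h.boundary_eq v w h.ne, if_pos rfl]
  by_cases h0 : pathChain l {v, w} = 0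
  · rw [h0, zero_add]
  · obtain ⟨l₁, a, b, l₂, rfl, h2⟩ := exists_of_pathChain_ne_zero h0
    obtain ⟨rfl, rfl⟩ := h.eq_nil_of_consecutive h2.symm
    simp at hl

/-- Every vertex of the boundary path lies in a triangle of the disk. -/
theorem exists_of_mem (h : Disk K f v w l) (hl : 3 ≤ l.length) {x : V} (hx : x ∈ l) :
    ∃ t ∈ triangles K, f t = 1 ∧ x ∈ t := by
  obtain ⟨l₁, l₂, rfl⟩ := List.append_of_mem hx
  have key : ∃ y, boundary K f {x, y} = 1 := by
    cases l₂ with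
    | nil =>
      have := h.last
      obtain rfl : x = w := by simpa using this
      exact ⟨v, by rw [Finset.pair_comm]; exact h.boundary_root hl⟩
    | cons y l₂ =>
      refine ⟨y, h.boundary_consecutive ?_⟩
      cases l₁ with
      | nil => right; rintro rfl; simp at hl
      | cons => left; simp
  obtain ⟨y, hy⟩ := key
  obtain ⟨t, ht, h1, hx, -⟩ := chainEdge_of_boundary_eq_one hy
  exact ⟨t, ht, h1, hx⟩

theorem inner_ne {l₁ l₂ : List V} {a q b : V} (h : Disk K f v w (l₁ ++ a :: q :: b :: l₂)) :
    q ≠ v ∧ q ≠ w := by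
  have hn := h.nodup
  have hh := h.head
  have hl := h.last
  have hva : v ∈ l₁ ++ [a] := by
    refine List.mem_of_head? ?_
    rw [← hh]; simp [List.head?_append]
  have hwb : w ∈ b :: l₂ := by
    refine List.mem_of_getLast? ?_
    rw [← hl, List.append_cons l₁ a, List.append_cons _ q, List.getLast?_append_cons]
  grind

end Disk

end

/-! ### Cutting disks -/

section

variable {V : Type*} [Fintype V] [DecidableEq V] {K : AbstractSimplicialComplex V}

theorem zmod_two_eq_one {e : ZMod 2} (h : e ≠ 0) : e = 1 := by
  revert h; revert e; decide

theorem boundary_single {a q u : V} (ht : ({a, q, u} : Finset V) ∈ triangles K) {x y : V}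
    (hxy : x ≠ y) : boundary K (Pi.single {a, q, u} 1) {x, y} =
      (if ({x, y} : Finset V) = {a, q} then 1 else 0) +
      (if ({x, y} : Finset V) = {q, u} then 1 else 0) +
      if ({x, y} : Finset V) = {a, u} then 1 else 0 := by
  obtain ⟨h1, h2, h3⟩ := ne_of_mem_triangles ht
  rw [boundary, Finset.sum_filter, Finset.sum_eq_single_of_mem _ ht]
  · have pair : ∀ c d : V, ({x, y} : Finset V) = {c, d} ↔ (x = c ∧ y = d) ∨ (x = d ∧ y = c) := by
      intro c d
      rw [← Finset.coe_inj, Finset.coe_pair, Finset.coe_pair, Set.pair_eq_pair_iff]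
    simp only [pair, Pi.single_eq_same, Finset.insert_subset_iff, Finset.mem_insert,
      Finset.singleton_subset_iff, Finset.mem_singleton]
    grind
  · intro t _ hne
    simp [Pi.single_eq_of_ne hne]

namespace Disk

variable {f : Finset V → ZMod 2} {v w : V}

/-- Removing from a disk its triangle `aqu` at the edge `aq` of the boundary path, by adding the
triangle modulo 2, yields a disk if `u` is the vertex `b` that follows `q` or is off the path. The
new path goes from `a` directly to `b`, or through `u` to `q`. -/
theorem add_single {l₁ l₂ m : List V} {a q b u : V}
    (h : Disk K f v w (l₁ ++ a :: q :: b :: l₂)) (ht : ({a, q, u} : Finset V) ∈ triangles K)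
    (h1 : f {a, q, u} = 1)
    (hm : (u = b ∧ m = l₁ ++ a :: b :: l₂) ∨
      (u ∉ l₁ ++ a :: q :: b :: l₂ ∧ m = l₁ ++ a :: u :: q :: b :: l₂)) :
    Disk K (f + Pi.single {a, q, u} 1) v w m where
  head := by
    rw [← h.head]
    rcases hm with ⟨-, rfl⟩ | ⟨-, rfl⟩ <;> simp [List.head?_append]
  last := by
    rw [← h.last]
    rcases hm with ⟨-, rfl⟩ | ⟨-, rfl⟩ <;>
      simp only [List.getLast?_append_cons, List.getLast?_cons_cons]
  nodup := by
    have hn := h.nodup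
    rcases hm with ⟨-, rfl⟩ | ⟨hu, rfl⟩
    · rw [List.append_cons, List.nodup_middle, List.nodup_cons] at hn
      simpa using hn.2
    · rw [List.append_cons, List.nodup_middle, List.nodup_cons]
      simpa using ⟨by simpa using hu, by simpa using hn⟩
  ne := h.ne
  boundary_eq x y hxy := by
    rw [boundary_add, h.boundary_eq x y hxy, boundary_single ht hxy]
    have two : ∀ e : ZMod 2, e + e = 0 := CharTwo.add_self_eq_zero
    rcases hm with ⟨rfl, rfl⟩ | ⟨-, rfl⟩
    · rw [pathChain_append l₁ a (q :: u :: l₂), pathChain_append l₁ a (u :: l₂),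
        pathChain_cons_cons, pathChain_cons_cons, pathChain_cons_cons]
      linear_combination two (if ({x, y} : Finset V) = {a, q} then 1 else 0) +
        two (if ({x, y} : Finset V) = {q, u} then 1 else 0)
    · rw [pathChain_append l₁ a (q :: b :: l₂), pathChain_append l₁ a (u :: q :: b :: l₂),
        pathChain_cons_cons a q, pathChain_cons_cons a u, pathChain_cons_cons u q,
        Finset.pair_comm q u]
      linear_combination two (if ({x, y} : Finset V) = {a, q} then 1 else 0)
  proper := ⟨_, ht, by
    rw [Pi.add_apply, h1, Pi.single_eq_same]
    exact CharTwo.add_self_eq_zero _⟩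

/-- If an inner vertex `q` of the boundary path is joined inside the disk to no vertex of the path
other than its two neighbours, removing the star of `q` leaves a disk, whose boundary path is
obtained by replacing `q` with the link of `q` in the disk. The triangles at `q` are removed one by
one, from `a` to `b`. -/
theorem remove_star (hK : IsTriangulatedTwoSphere K) {l₁ l₂ : List V} {a q b : V}
    (h : Disk K f v w (l₁ ++ a :: q :: b :: l₂))
    (hq : ∀ x ∈ l₁ ++ a :: q :: b :: l₂, ChainEdge K f q x → x = a ∨ x = q ∨ x = b) :
    ∃ l', Disk K (fun t => if q ∈ t then 0 else f t) v w l' ∧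
      ∀ x, x ∈ l' ↔ x ≠ q ∧ (x ∈ l₁ ++ a :: q :: b :: l₂ ∨ ChainEdge K f q x) := by
  induction hn : ((triangles K).filter fun t => q ∈ t ∧ f t = 1).card using
    Nat.strong_induction_on generalizing f l₁ a with
  | _ n ih =>
  subst hn
  have hnd := h.nodup
  have haq : a ≠ q := by grind
  have hb1 : boundary K f {a, q} = 1 := h.boundary_consecutive (by simp)
  have hadj : (oneSkeleton K).Adj a q := (chainEdge_of_boundary_eq_one hb1).adj haq
  -- exactly one of the two triangles at the edge `aq` is in the disk
  obtain ⟨t₁, t₂, ht₁, ht₂, hat₁, hqt₁, hall, h1, h2⟩ : ∃ t₁ t₂, t₁ ∈ triangles K ∧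
      t₂ ∈ triangles K ∧ a ∈ t₁ ∧ q ∈ t₁ ∧
      (∀ t ∈ triangles K, a ∈ t → q ∈ t → t = t₁ ∨ t = t₂) ∧ f t₁ = 1 ∧ f t₂ = 0 := by
    obtain ⟨t₁, ht₁, t₂, ht₂, -, ha1, hq1, ha2, hq2, hall, hb⟩ := hK.exists_boundary_eq hadj
    have := hb f
    rw [hb1] at this
    by_cases h0 : f t₁ = 0
    · refine ⟨t₂, t₁, ht₂, ht₁, ha2, hq2, fun t ht h h' => (hall t ht h h').symm, ?_, h0⟩
      rw [this, h0, zero_add]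
    · refine ⟨t₁, t₂, ht₁, ht₂, ha1, hq1, hall, zmod_two_eq_one h0, ?_⟩
      rw [zmod_two_eq_one h0] at this
      simpa using this
  obtain ⟨u, hua, huq, rfl⟩ := exists_eq_of_mem_triangle ht₁ hat₁ hqt₁ haq
  have hEu : ChainEdge K f q u := ⟨_, ht₁, h1, by simp, by simp⟩
  set t₁ : Finset V := {a, q, u}
  set g : Finset V → ZMod 2 := f + Pi.single t₁ 1 with hg
  have hg1 : g t₁ = 0 := by
    simp [hg, h1, CharTwo.add_self_eq_zero]
  have hgne : ∀ t, t ≠ t₁ → g t = f t := by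
    intro t ht
    simp [hg, Pi.single_eq_of_ne ht]
  have hfun : (fun t => if q ∈ t then 0 else g t) = fun t => if q ∈ t then 0 else f t := by
    ext t
    split_ifs with hqt
    · rfl
    · exact hgne t (by rintro rfl; exact hqt hqt₁)
  by_cases hub : u = b
  · have hD := h.add_single ht₁ h1 (Or.inl ⟨hub, rfl⟩)
    have hq' : q ∉ l₁ ++ a :: b :: l₂ := by grind
    have hstar : ∀ t ∈ triangles K, q ∈ t → g t = 0 := fun t ht hqt =>
      (hD.eq_of_not_mem hK hq' ht ht₁ hqt hqt₁).trans hg1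
    refine ⟨_, hD.congr fun t ht => ?_, fun x => ?_⟩
    · change g t = _
      split_ifs with hqt
      · exact hstar t ht hqt
      · exact hgne t (by rintro rfl; exact hqt hqt₁)
    · constructor
      · intro hx
        grind
      · rintro ⟨hxq, hx | ⟨t, ht, hft, hqt, hxt⟩⟩
        · grind
        · have : t = t₁ := by
            by_contra hne
            rw [← hgne t hne, hstar t ht hqt] at hft
            exact zero_ne_one hft
          grind
  · have hul : u ∉ l₁ ++ a :: q :: b :: l₂ := by
      intro hmem
      rcases hq u hmem hEu with h | h | h
      · exact hua h
      · exact huq h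
      · exact hub h
    have hD := h.add_single ht₁ h1 (Or.inr ⟨hul, rfl⟩)
    rw [List.append_cons] at hD
    have hsub : ∀ t, g t = 1 → t ≠ t₁ ∧ f t = 1 := by
      intro t ht
      have hne : t ≠ t₁ := by
        rintro rfl
        rw [hg1] at ht
        exact zero_ne_one ht
      exact ⟨hne, by rw [← hgne t hne, ht]⟩
    have hlt : ((triangles K).filter fun t => q ∈ t ∧ g t = 1).card <
        ((triangles K).filter fun t => q ∈ t ∧ f t = 1).card := by
      refine Finset.card_lt_card (Finset.ssubset_iff_of_subset ?_ |>.2 ⟨t₁, ?_, ?_⟩)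
      · intro t ht
        simp only [Finset.mem_filter] at ht ⊢
        exact ⟨ht.1, ht.2.1, (hsub t ht.2.2).2⟩
      · simp only [Finset.mem_filter]
        exact ⟨ht₁, hqt₁, h1⟩
      · simp only [Finset.mem_filter, hg1]
        simp
    obtain ⟨l', hl', hmem⟩ := ih _ hlt hD (by
      rintro x hx ⟨t, ht, hgt, hqt, hxt⟩
      obtain ⟨hne, hft⟩ := hsub t hgt
      by_cases hxa : x = a
      · subst hxa
        rcases hall t ht hxt hqt with h | h
        · exact absurd h hne
        · rw [h, h2] at hft
          exact absurd hft zero_ne_one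
      · by_cases hxu : x = u
        · exact Or.inl hxu
        · have := hq x (by grind) ⟨t, ht, hft, hqt, hxt⟩
          grind) rfl
    rw [hfun] at hl'
    refine ⟨l', hl', fun x => ?_⟩
    rw [hmem]
    refine and_congr_right fun hxq => ⟨?_, ?_⟩
    · rintro (hx | ⟨t, ht, hgt, hqt, hxt⟩)
      · by_cases hxu : x = u
        · subst hxu; exact Or.inr hEu
        · left; grind
      · exact Or.inr ⟨t, ht, (hsub t hgt).2, hqt, hxt⟩
    · rintro (hx | ⟨t, ht, hft, hqt, hxt⟩)
      · left; grind
      · by_cases hne : t = t₁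
        · left; grind
        · exact Or.inr ⟨t, ht, (hgne t hne).trans hft, hqt, hxt⟩

/-- A chord `yz` cuts a disk into two disks with disjoint sets of triangles. The path from `y` to
`z` closed by the chord bounds some chain, since the first homology vanishes; this chain or its
complement lies in the disk. -/
theorem split (hK : IsTriangulatedTwoSphere K) {l₁ mid l₂ : List V} {y z : V}
    (h : Disk K f v w (l₁ ++ y :: (mid ++ z :: l₂))) (hmid : mid ≠ [])
    (hyz : ChainEdge K f y z) :
    ∃ f₁ f₂, Disk K f₁ v w (l₁ ++ y :: z :: l₂) ∧ Disk K f₂ y z (y :: (mid ++ [z])) ∧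
      (∀ t ∈ triangles K, f t = f₁ t + f₂ t) ∧ (∀ t ∈ triangles K, f₂ t = 1 → f t = 1) := by
  obtain ⟨m₀, mid, rfl⟩ := List.exists_cons_of_ne_nil hmid
  have hn := h.nodup
  have hyz' : y ≠ z := by grind
  have hadj := hyz.adj hyz'
  set l := l₁ ++ y :: ((m₀ :: mid) ++ z :: l₂) with hl
  set c : List V := y :: ((m₀ :: mid) ++ [z]) with hc
  have hcn : c.Nodup := by grind
  have hlen : 3 ≤ l.length := by simp [hl]; omega
  -- the edges of the inner path are boundary edges of the disk
  have hsub : ∀ s, pathChain c s ≠ 0 → boundary K f s = 1 := by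
    intro s hs
    obtain ⟨n₁, a, b, n₂, hn', rfl⟩ := exists_of_pathChain_ne_zero hs
    have hl' : l = (l₁ ++ n₁) ++ a :: b :: (n₂ ++ l₂) := by
      have : l = l₁ ++ c ++ l₂ := by simp [hl, hc]
      rw [this, hn']; simp
    have h' := h
    rw [hl'] at h' hlen
    refine h'.boundary_consecutive ?_
    by_contra! hcon
    rw [hcon.1, hcon.2] at hlen
    simp at hlen
  -- a chain bounded by the inner path and the chord
  obtain ⟨e, he⟩ := hK.exists_boundary_eq_of_cycle
    (fun s => pathChain c s + if s = {y, z} then 1 else 0)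
    (by
      intro x x' hxx hK'
      have h1 : ¬ pathChain c {x, x'} ≠ 0 := fun h0 =>
        hK' ((chainEdge_of_boundary_eq_one (hsub _ h0)).adj hxx).2
      rw [not_ne_iff.1 h1, if_neg, add_zero]
      intro h2
      exact hK' (h2 ▸ hadj.2))
    (by
      intro x
      rw [Finset.sum_add_distrib, sum_pathChain hcn (v := y) (w := z) rfl
        (by rw [hc, ← List.cons_append, List.getLast?_concat]), sum_edge_indicator hyz']
      exact CharTwo.add_self_eq_zero _)
  -- its part outside the disk is bounded by all or none of the boundary of the disk
  set D : Finset V → ZMod 2 := fun t => (1 - f t) * e t with hD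
  have hDsupp : ∀ x x', x ≠ x' → boundary K D {x, x'} ≠ 0 → boundary K f {x, x'} = 1 := by
    intro x x' hxx hne0
    by_contra hf1
    have hf0 : boundary K f {x, x'} = 0 := by
      by_contra h0; exact hf1 (zmod_two_eq_one h0)
    have hxadj : (oneSkeleton K).Adj x x' := by
      refine ⟨hxx, ?_⟩
      by_contra hK'
      exact hne0 (UnstableBlueprint.boundary_eq_zero_of_not_mem (by simp) hK')
    obtain ⟨t₁, ht₁, t₂, ht₂, -, hx1, hx1', hx2, hx2', hall, hb⟩ := hK.exists_boundary_eq hxadj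
    rw [hb] at hf0 hne0
    have hf12 : f t₁ = f t₂ := CharTwo.add_eq_zero.1 hf0
    have hbe := hb e
    rw [he x x' hxx] at hbe
    have hprod : (1 - f t₁) * (e t₁ + e t₂) ≠ 0 := by
      intro h0
      refine hne0 ?_
      simp only [hD, ← hf12]
      rw [← mul_add, h0]
    rw [← hbe] at hprod
    by_cases hp : pathChain c {x, x'} = 0
    · by_cases hyx : ({x, x'} : Finset V) = {y, z}
      · obtain ⟨t, ht, h1, hyt, hzt⟩ := hyz
        have hxt : x ∈ t := by
          have : x ∈ ({y, z} : Finset V) := by rw [← hyx]; simp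
          grind
        have hxt' : x' ∈ t := by
          have : x' ∈ ({y, z} : Finset V) := by rw [← hyx]; simp
          grind
        have h11 : f t₁ = 1 := by
          rcases hall t ht hxt hxt' with rfl | rfl
          · exact h1
          · rw [hf12, h1]
        rw [h11] at hprod
        simp at hprod
      · rw [hp, if_neg hyx] at hprod
        simp at hprod
    · exact hf1 (hsub _ hp)
  have hconst : ∃ k : ZMod 2, ∀ s ∈ triangles K, ∀ t ∈ triangles K,
      D s + k * f s = D t + k * f t := by
    refine ⟨boundary K D {v, w}, fun s hs t ht => ?_⟩
    have hlin : ∀ x x', boundary K (fun t => D t + boundary K D {v, w} * f t) {x, x'} =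
        boundary K D {x, x'} + boundary K D {v, w} * boundary K f {x, x'} := by
      intro x x'
      simp only [boundary, Finset.sum_add_distrib, Finset.mul_sum]
    refine hK.eq_of_boundary_eq_zero (f := fun t => D t + boundary K D {v, w} * f t)
      (fun x x' hxx => ?_) hs ht
    refine eq_zero_of_support_path (boundary K fun t => D t + boundary K D {v, w} * f t)
      (sum_boundary_eq_zero _) hn (fun a b hab h0 => ?_) x x' hxx.1
    rw [hlin] at h0
    have hf1 : boundary K f {a, b} = 1 := by
      by_contra hf1
      have hf0 : boundary K f {a, b} = 0 := by
        by_contra h0; exact hf1 (zmod_two_eq_one h0)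
      rw [hf0, mul_zero, add_zero] at h0
      exact hf1 (hDsupp a b hab h0)
    intro hp
    by_cases hab' : ({a, b} : Finset V) = {v, w}
    · rw [hab', h.boundary_root hlen, mul_one] at h0
      exact h0 (CharTwo.add_self_eq_zero _)
    · rw [h.boundary_eq a b hab, hp, if_neg hab'] at hf1
      simp at hf1
  -- hence the chain or its complement lies in the disk
  obtain ⟨f₂, hf₂, hf₂f⟩ : ∃ f₂, (∀ x x', (oneSkeleton K).Adj x x' →
      boundary K f₂ {x, x'} = boundary K e {x, x'}) ∧ ∀ t ∈ triangles K, f₂ t = 1 → f t = 1 := by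
    obtain ⟨k, hk⟩ := hconst
    obtain ⟨t₀, ht₀, h₀, -⟩ := hyz
    have h2 : ∀ c : ZMod 2, c = 0 ∨ c = 1 := by decide
    have hD₀ : D t₀ = 0 := by simp [hD, h₀]
    rcases h2 k with rfl | rfl
    · refine ⟨e, fun _ _ _ => rfl, fun t ht he1 => ?_⟩
      have := hk t ht t₀ ht₀
      rw [hD₀, zero_mul, zero_mul, add_zero, add_zero] at this
      simp only [hD, he1, mul_one] at this
      exact (sub_eq_zero.1 this).symm
    · refine ⟨fun t => 1 + e t, fun x x' hxx => ?_, fun t ht he1 => ?_⟩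
      · obtain ⟨t₁, -, t₂, -, -, -, -, -, -, -, hb⟩ := hK.exists_boundary_eq hxx
        rw [hb, hb]
        linear_combination CharTwo.add_self_eq_zero (1 : ZMod 2)
      · have he0 : e t = 0 := by simpa using he1
        have := hk t ht t₀ ht₀
        rw [hD₀, h₀] at this
        simpa [hD, he0] using this
  have hbf₂ : ∀ x x', x ≠ x' → boundary K f₂ {x, x'} =
      pathChain c {x, x'} + if ({x, x'} : Finset V) = {y, z} then 1 else 0 := by
    intro x x' hxx
    rw [← he x x' hxx]
    by_cases hK' : ({x, x'} : Finset V) ∈ K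
    · exact hf₂ x x' ⟨hxx, hK'⟩
    · rw [UnstableBlueprint.boundary_eq_zero_of_not_mem (by simp) hK',
        UnstableBlueprint.boundary_eq_zero_of_not_mem (by simp) hK']
  obtain ⟨t₀, ht₀, h₀⟩ := h.proper
  have h₂₀ : f₂ t₀ = 0 := by
    by_contra h'
    rw [hf₂f t₀ ht₀ (zmod_two_eq_one h')] at h₀
    exact one_ne_zero h₀
  refine ⟨f + f₂, f₂, ⟨?_, ?_, ?_, h.ne, fun x x' hxx => ?_, t₀, ht₀, ?_⟩,
    ⟨rfl, ?_, hcn, hyz', hbf₂, t₀, ht₀, h₂₀⟩, fun t _ => ?_, hf₂f⟩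
  · rw [← h.head, hl]; simp [List.head?_append]
  · rw [← h.last, hl, ← List.cons_append, List.append_cons l₁ y, ← List.append_assoc,
      List.getLast?_append_cons, List.getLast?_append_cons]
  · grind
  · rw [boundary_add, hbf₂ x x' hxx, h.boundary_eq x x' hxx, hl, pathChain_append,
      pathChain_append l₁ y (z :: l₂),
      show y :: (m₀ :: mid ++ z :: l₂) = (y :: m₀ :: mid) ++ z :: l₂ from rfl,
      pathChain_append (y :: m₀ :: mid), pathChain_cons_cons y z, hc]
    simp only [List.cons_append]
    linear_combination CharTwo.add_self_eq_zero (pathChain (y :: m₀ :: (mid ++ [z])) {x, x'})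
  · simp [h₀, h₂₀]
  · rw [hc, ← List.cons_append, List.getLast?_concat]
  · rw [Pi.add_apply, add_assoc, CharTwo.add_self_eq_zero, add_zero]

end Disk

end

/-! ### Stresses of graphs and of their lifts -/

section

/-- If `F` is injective, so is `F + s G` for some `s ≠ 0`. -/
theorem exists_ker_add_smul_eq_bot {X Y : Type*} [AddCommGroup X] [Module ℝ X]
    [FiniteDimensional ℝ X] [AddCommGroup Y] [Module ℝ Y] (F G : X →ₗ[ℝ] Y)
    (hF : LinearMap.ker F = ⊥) : ∃ s : ℝ, s ≠ 0 ∧ LinearMap.ker (F + s • G) = ⊥ := by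
  obtain ⟨L, hL⟩ := F.exists_leftInverse_of_injective hF
  -- for a left inverse `L` of `F`, the kernel of `F + s G` consists of eigenvectors of `L G`
  have hfin : Set.Finite ({μ : ℝ | Module.End.HasEigenvalue (L ∘ₗ G) μ} ∪ {0}) :=
    (Module.End.finite_hasEigenvalue _).union (Set.finite_singleton 0)
  obtain ⟨μ, hμ⟩ := hfin.exists_notMem
  simp only [Set.mem_union, Set.mem_singleton_iff, not_or] at hμ
  refine ⟨-μ⁻¹, neg_ne_zero.2 (inv_ne_zero hμ.2), ?_⟩
  rw [LinearMap.ker_eq_bot']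
  intro x hx
  by_contra hx0
  refine hμ.1 (Module.End.hasEigenvalue_of_hasEigenvector (x := x)
    (Module.End.hasEigenvector_iff.2 ⟨Module.End.mem_eigenspace_iff.2 ?_, hx0⟩))
  have h1 := congrArg L hx
  have h2 : L (F x) = x := LinearMap.congr_fun hL x
  simp only [LinearMap.add_apply, LinearMap.smul_apply, map_add, map_smul, map_zero, h2] at h1
  have h3 : x = μ⁻¹ • L (G x) := by
    rw [neg_smul, ← sub_eq_add_neg, sub_eq_zero] at h1
    exact h1
  rw [LinearMap.comp_apply, h3, smul_smul, mul_inv_cancel₀ hμ.2, one_smul, ← h3]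

theorem exists_functional_of_pair {E : Type*} [AddCommGroup E] [Module ℝ E] {x y : E}
    (h : ∀ α β : ℝ, α • x + β • y = 0 → α = 0 ∧ β = 0) (a b : ℝ) :
    ∃ g : E →ₗ[ℝ] ℝ, g x = a ∧ g y = b := by
  let T : ℝ × ℝ →ₗ[ℝ] E :=
    (LinearMap.toSpanSingleton ℝ E x).coprod (LinearMap.toSpanSingleton ℝ E y)
  have hT : LinearMap.ker T = ⊥ := by
    rw [LinearMap.ker_eq_bot']
    rintro ⟨α, β⟩ h0
    obtain ⟨rfl, rfl⟩ := h α β (by simpa [T] using h0)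
    rfl
  obtain ⟨L, hL⟩ := T.exists_leftInverse_of_injective hT
  have hx : L x = (1, 0) := by
    have := LinearMap.congr_fun hL (1, 0)
    simpa [T] using this
  have hy : L y = (0, 1) := by
    have := LinearMap.congr_fun hL (0, 1)
    simpa [T] using this
  exact ⟨a • LinearMap.fst ℝ ℝ ℝ ∘ₗ L + b • LinearMap.snd ℝ ℝ ℝ ∘ₗ L, by simp [hx], by simp [hy]⟩

variable {V E : Type*} [Fintype V] [AddCommGroup E] [Module ℝ E]

/-- The symmetric weights `ω` on the edges in `R` and on the vertices that vanish on the edge `vw`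
and its two ends, and satisfy two sets of equilibrium conditions: `∑ y, ω x y • p y = 0` at every
`x ≠ v, w`, and `∑ y, ω x y * ℓ y = 0` at every `x ∉ A`. Adding to a stress of a disk an
arbitrary weight on `vw`, `v` and `w` does not affect the conditions, hence the normalization. -/
def stressSpace (R : V → V → Prop) (v w : V) (A : Set V) (p : V → E) (ℓ : V → ℝ) :
    Submodule ℝ (V → V → ℝ) where
  carrier := {ω | (∀ x y, ω x y = ω y x) ∧ (∀ x y, x ≠ y → ¬R x y → ω x y = 0) ∧
    (ω v w = 0 ∧ ω v v = 0 ∧ ω w w = 0) ∧ (∀ x, x ≠ v → x ≠ w → ∑ y, ω x y • p y = 0) ∧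
    ∀ x, x ∉ A → ∑ y, ω x y * ℓ y = 0}
  add_mem' := by
    rintro ω ω' ⟨h1, h2, ⟨h3, h4, h5⟩, h6, h7⟩ ⟨h1', h2', ⟨h3', h4', h5'⟩, h6', h7'⟩
    refine ⟨fun x y => ?_, fun x y hxy hR => ?_, ⟨?_, ?_, ?_⟩, fun x hv hw => ?_, fun x hx => ?_⟩
    · simp [h1 x y, h1' x y]
    · simp [h2 x y hxy hR, h2' x y hxy hR]
    · simp [h3, h3']
    · simp [h4, h4']
    · simp [h5, h5']
    · simp [add_smul, Finset.sum_add_distrib, h6 x hv hw, h6' x hv hw]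
    · simp [add_mul, Finset.sum_add_distrib, h7 x hx, h7' x hx]
  zero_mem' := by simp
  smul_mem' := by
    rintro c ω ⟨h1, h2, ⟨h3, h4, h5⟩, h6, h7⟩
    refine ⟨fun x y => ?_, fun x y hxy hR => ?_, ⟨?_, ?_, ?_⟩, fun x hv hw => ?_, fun x hx => ?_⟩
    · simp [h1 x y]
    · simp [h2 x y hxy hR]
    · simp [h3]
    · simp [h4]
    · simp [h5]
    · simp [mul_smul, ← Finset.smul_sum, h6 x hv hw]
    · simp [mul_assoc, ← Finset.mul_sum, h7 x hx]

theorem mem_stressSpace {R : V → V → Prop} {v w : V} {A : Set V} {p : V → E} {ℓ : V → ℝ}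
    {ω : V → V → ℝ} : ω ∈ stressSpace R v w A p ℓ ↔
    (∀ x y, ω x y = ω y x) ∧ (∀ x y, x ≠ y → ¬R x y → ω x y = 0) ∧
    (ω v w = 0 ∧ ω v v = 0 ∧ ω w w = 0) ∧ (∀ x, x ≠ v → x ≠ w → ∑ y, ω x y • p y = 0) ∧
    ∀ x, x ∉ A → ∑ y, ω x y * ℓ y = 0 := Iff.rfl

variable [DecidableEq V]

/-- Let `a`, `b` be the only vertices of `A` adjacent to `q`, and `p a`, `p q`, `p b` linearly
independent. For a very large value of `ℓ` at `q`, the equilibrium conditions at the neighbours of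
`q` outside `A` force the weights of the edges to `q` to vanish, and the condition at `q` then kills
the weights of `qa` and `qb`. So it suffices to consider the graph without `q`, with no condition
on `ℓ` at the neighbours of `q`. -/
theorem exists_stressSpace_update_eq_bot {R R' : V → V → Prop} {v w q a b : V} {A A' : Set V}
    {p : V → E} {ℓ : V → ℝ} (hR : ∀ x y, R x y → R y x) (hqv : q ≠ v) (hqw : q ≠ w) (hqA : q ∈ A)
    (hA' : ∀ x, x ∈ A' ↔ x ≠ q ∧ (x ∈ A ∨ R q x)) (hab : a ≠ b) (haq : a ≠ q) (hbq : b ≠ q)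
    (hind : ∀ α β γ : ℝ, α • p a + β • p q + γ • p b = 0 → α = 0 ∧ β = 0 ∧ γ = 0)
    (hq : ∀ x ∈ A, x ≠ q → R q x → x = a ∨ x = b)
    (hR' : ∀ x y, x ≠ q → y ≠ q → x ≠ y → R x y →
      R' x y ∨ (x = v ∧ y = w) ∨ (x = w ∧ y = v))
    (h : stressSpace R' v w A' p ℓ = ⊥) :
    ∃ t : ℝ, stressSpace R v w A p (Function.update ℓ q t) = ⊥ := by
  classical
  -- weights that satisfy all conditions that do not involve the height of `q`; for such weights
  -- `F` collects the coefficients of that height in the remaining conditions, `G` the other terms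
  set X := stressSpace R v w (A ∪ {x | R q x}) p ℓ with hX
  let F : X →ₗ[ℝ] (V → ℝ) :=
    { toFun := fun ω u => if u ∈ A then 0 else ω.1 u q
      map_add' := fun ω ω' => by ext u; by_cases hu : u ∈ A <;> simp [hu]
      map_smul' := fun c ω => by ext u; by_cases hu : u ∈ A <;> simp [hu] }
  let G : X →ₗ[ℝ] (V → ℝ) :=
    { toFun := fun ω u => if u ∈ A then 0 else ∑ y ∈ Finset.univ.erase q, ω.1 u y * ℓ y
      map_add' := fun ω ω' => by
        ext u; by_cases hu : u ∈ A <;> simp [hu, add_mul, Finset.sum_add_distrib]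
      map_smul' := fun c ω => by
        ext u
        by_cases hu : u ∈ A
        · simp [hu]
        · simp [hu, mul_assoc, ← Finset.mul_sum, mul_sub] }
  have hF : LinearMap.ker F = ⊥ := by
    rw [LinearMap.ker_eq_bot']
    rintro ⟨ω, hω⟩ h0
    obtain ⟨h1, h2, h3, h4, h5⟩ := mem_stressSpace.1 hω
    have hFu : ∀ u, u ∉ A → ω u q = 0 := by
      intro u hu
      have : F ⟨ω, hω⟩ u = 0 := by rw [h0]; rfl
      simpa [F, hu] using this
    have hqx : ∀ x, x ≠ a → x ≠ q → x ≠ b → ω q x = 0 := by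
      intro x hxa hxq hxb
      by_cases hxA : x ∈ A
      · refine h2 q x hxq.symm fun hRq => ?_
        rcases hq x hxA hxq hRq with h | h
        · exact hxa h
        · exact hxb h
      · rw [h1, hFu x hxA]
    have hbal := h4 q hqv hqw
    have hsum : ∑ y, ω q y • p y = ω q a • p a + ω q q • p q + ω q b • p b := by
      rw [← Finset.sum_subset (Finset.subset_univ ({a, q, b} : Finset V))]
      · rw [Finset.sum_insert (by simp [haq, hab]), Finset.sum_pair hbq.symm, add_assoc]
      · intro x _ hx
        simp only [Finset.mem_insert, Finset.mem_singleton, not_or] at hx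
        rw [hqx x hx.1 hx.2.1 hx.2.2, zero_smul]
    rw [hsum] at hbal
    obtain ⟨ha, hqq, hb⟩ := hind _ _ _ hbal
    have hq0 : ∀ x, ω q x = 0 := by
      intro x
      by_cases hxa : x = a
      · rw [hxa, ha]
      by_cases hxq : x = q
      · rw [hxq, hqq]
      by_cases hxb : x = b
      · rw [hxb, hb]
      exact hqx x hxa hxq hxb
    have hmem : ω ∈ stressSpace R' v w A' p ℓ := by
      refine mem_stressSpace.2 ⟨h1, fun x y hxy hn => ?_, h3, h4, fun x hx => ?_⟩
      · by_cases hxq : x = q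
        · rw [hxq, hq0]
        by_cases hyq : y = q
        · rw [hyq, h1, hq0]
        by_cases hRxy : R x y
        · rcases hR' x y hxq hyq hxy hRxy with h | ⟨rfl, rfl⟩ | ⟨rfl, rfl⟩
          · exact absurd h hn
          · exact h3.1
          · rw [h1]; exact h3.1
        · exact h2 x y hxy hRxy
      · by_cases hxq : x = q
        · simp [hxq, hq0]
        · refine h5 x ?_
          rw [hA'] at hx
          simp only [Set.mem_union, Set.mem_ofPred_eq]
          tauto
    rw [h, Submodule.mem_bot] at hmem
    exact Subtype.ext hmem
  obtain ⟨s, hs, hker⟩ := exists_ker_add_smul_eq_bot F G hF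
  refine ⟨s⁻¹, (Submodule.eq_bot_iff _).2 fun ω hω => ?_⟩
  obtain ⟨h1, h2, h3, h4, h5⟩ := mem_stressSpace.1 hω
  have hupd : ∀ x, ∑ y, ω x y * Function.update ℓ q s⁻¹ y =
      ω x q * s⁻¹ + ∑ y ∈ Finset.univ.erase q, ω x y * ℓ y := by
    intro x
    rw [← Finset.add_sum_erase _ _ (Finset.mem_univ q), Function.update_self]
    congr 1
    exact Finset.sum_congr rfl fun y hy => by
      rw [Function.update_of_ne (Finset.ne_of_mem_erase hy)]
  have hωX : ω ∈ X := by
    refine mem_stressSpace.2 ⟨h1, h2, h3, h4, fun x hx => ?_⟩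
    simp only [Set.mem_union, Set.mem_ofPred_eq, not_or] at hx
    have hxq : x ≠ q := by rintro rfl; exact hx.1 hqA
    have h0 : ω x q = 0 := h2 x q hxq fun h => hx.2 (hR _ _ h)
    rw [← Finset.add_sum_erase _ _ (Finset.mem_univ q), h0, zero_mul]
    have := h5 x hx.1
    rwa [hupd, h0, zero_mul] at this
  have hz : (F + s • G) ⟨ω, hωX⟩ = 0 := by
    ext u
    by_cases hu : u ∈ A
    · simp [F, G, hu]
    · have := h5 u hu
      rw [hupd] at this
      simp only [F, G, LinearMap.add_apply, LinearMap.smul_apply, LinearMap.coe_mk,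
        AddHom.coe_mk, Pi.add_apply, Pi.smul_apply, hu, if_false, smul_eq_mul, Pi.zero_apply]
      linear_combination s * this - ω u q * mul_inv_cancel₀ hs
  have := (LinearMap.ker_eq_bot'.1 hker) _ hz
  exact congrArg Subtype.val this

/-- Two graphs that meet in the edge `yz` can be treated one after the other: first the second
graph, rooted at `yz`, then the first one. Adding a linear form to the second lift, which does not
affect its stresses, makes the two lifts agree at `y` and `z`. -/
theorem exists_stressSpace_union_eq_bot {R R₁ R₂ : V → V → Prop} {v w y z : V}
    {A A₁ A₂ V₁ V₂ : Set V} {p : V → E} {ℓ₁ ℓ₂ : V → ℝ}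
    (hR : ∀ x x', R x x' → R₁ x x' ∨ R₂ x x') (hR₂ : ∀ x x', R₂ x x' → R₂ x' x)
    (hV₁ : ∀ x x', R₁ x x' → x ∈ V₁ ∧ x' ∈ V₁) (hV₂ : ∀ x x', R₂ x x' → x ∈ V₂ ∧ x' ∈ V₂)
    (hV : ∀ x, x ∈ V₁ → x ∈ V₂ → x = y ∨ x = z) (hyz : R₁ y z) (hzy : R₁ z y)
    (hA : A ⊆ A₁ ∪ A₂) (hAV₁ : A₁ ⊆ V₁) (hAV₂ : A₂ ⊆ V₂) (hy₁ : y ∈ A₁) (hz₁ : z ∈ A₁)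
    (hy₂ : y ∈ A₂) (hz₂ : z ∈ A₂) (hv : v ∈ A₁) (hw : w ∈ A₁)
    (hind : ∀ α β : ℝ, α • p y + β • p z = 0 → α = 0 ∧ β = 0)
    (h₁ : stressSpace R₁ v w A₁ p ℓ₁ = ⊥) (h₂ : stressSpace R₂ y z A₂ p ℓ₂ = ⊥) :
    ∃ ℓ : V → ℝ, stressSpace R v w A p ℓ = ⊥ := by
  classical
  obtain ⟨g, hgy, hgz⟩ := exists_functional_of_pair hind (ℓ₁ y - ℓ₂ y) (ℓ₁ z - ℓ₂ z)
  let ℓ : V → ℝ := fun x => if x ∈ V₂ then ℓ₂ x + g (p x) else ℓ₁ x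
  have hℓ₂ : ∀ x ∈ V₂, ℓ x = ℓ₂ x + g (p x) := fun x hx => if_pos hx
  have hℓ₁ : ∀ x, (x ∈ V₂ → x = y ∨ x = z) → ℓ x = ℓ₁ x := by
    intro x hx
    by_cases hx2 : x ∈ V₂
    · rw [hℓ₂ x hx2]
      rcases hx hx2 with rfl | rfl
      · rw [hgy]; ring
      · rw [hgz]; ring
    · exact if_neg hx2
  refine ⟨ℓ, (Submodule.eq_bot_iff _).2 fun ω hω => ?_⟩
  obtain ⟨s1, s2, s3, s4, s5⟩ := mem_stressSpace.1 hω
  -- the restriction of the stress to the second graph, normalized at the root `yz`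
  let ω₂ : V → V → ℝ := fun x b =>
    if x = b then (if x ∈ V₂ ∧ x ≠ y ∧ x ≠ z then ω x x else 0)
    else if R₂ x b ∧ ¬((x = y ∧ b = z) ∨ (x = z ∧ b = y)) then ω x b else 0
  have hin : ∀ x, x ∈ V₂ → x ≠ y → x ≠ z → ∀ b, ω₂ x b = ω x b := by
    intro x hx hxy hxz b
    by_cases hxb : x = b
    · subst hxb; simp [ω₂, hx, hxy, hxz]
    · by_cases hR2 : R₂ x b
      · simp [ω₂, hxb, hR2, hxy, hxz]
      · have : ω x b = 0 := s2 x b hxb fun hRx => by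
          rcases hR x b hRx with h | h
          · rcases hV x (hV₁ x b h).1 hx with h | h
            · exact hxy h
            · exact hxz h
          · exact hR2 h
        simp [ω₂, hxb, hR2, this]
  have hout : ∀ x, x ∉ V₂ → ∀ b, ω₂ x b = 0 := by
    intro x hx b
    have hR2 : ¬R₂ x b := fun h => hx (hV₂ x b h).1
    simp [ω₂, hx, hR2]
  have hnb : ∀ x b, x ∈ V₂ → x ≠ y → x ≠ z → ω x b ≠ 0 → b ∈ V₂ := by
    intro x b hx hxy hxz h0
    rw [← hin x hx hxy hxz] at h0
    by_contra hb
    have hxb : x ≠ b := by rintro rfl; exact hb hx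
    have hR2 : ¬R₂ x b := fun h => hb (hV₂ x b h).2
    exact h0 (by simp [ω₂, hxb, hR2])
  have hmem₂ : ω₂ ∈ stressSpace R₂ y z A₂ p ℓ₂ := by
    refine mem_stressSpace.2 ⟨fun x b => ?_, fun x b hxb hn => ?_, ⟨?_, ?_, ?_⟩,
      fun x hxy hxz => ?_, fun x hx => ?_⟩
    · by_cases hxb : x = b
      · subst hxb; rfl
      · have hsymm : R₂ x b ↔ R₂ b x := ⟨hR₂ _ _, hR₂ _ _⟩
        simp only [ω₂, hxb, Ne.symm hxb, if_false, hsymm, s1 x b]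
        congr 1
        simp only [eq_iff_iff]
        tauto
    · simp [ω₂, hxb, hn]
    · by_cases hyz' : y = z <;> simp [ω₂, hyz']
    · simp [ω₂]
    · simp [ω₂]
    · by_cases hx : x ∈ V₂
      · simp only [hin x hx hxy hxz]
        refine s4 x ?_ ?_
        · rintro rfl
          rcases hV _ (hAV₁ hv) hx with h | h
          · exact hxy h
          · exact hxz h
        · rintro rfl
          rcases hV _ (hAV₁ hw) hx with h | h
          · exact hxy h
          · exact hxz h
      · simp [hout x hx]
    · by_cases hx2 : x ∈ V₂
      · have hxy : x ≠ y := by rintro rfl; exact hx hy₂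
        have hxz : x ≠ z := by rintro rfl; exact hx hz₂
        have hV1 : x ∉ V₁ := fun h => by
          rcases hV x h hx2 with h | h
          · exact hxy h
          · exact hxz h
        have hxA : x ∉ A := fun h => by
          rcases hA h with h | h
          · exact hV1 (hAV₁ h)
          · exact hx h
        have hlift := s5 x hxA
        have hbal := s4 x (by rintro rfl; exact hV1 (hAV₁ hv)) (by rintro rfl; exact hV1 (hAV₁ hw))
        have hg : ∑ b, ω x b * g (p b) = 0 := by
          have := congrArg g hbal
          simpa using this
        simp only [hin x hx2 hxy hxz]
        have : ∑ b, ω x b * ℓ b = ∑ b, ω x b * ℓ₂ b + ∑ b, ω x b * g (p b) := by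
          rw [← Finset.sum_add_distrib]
          refine Finset.sum_congr rfl fun b _ => ?_
          by_cases h0 : ω x b = 0
          · simp [h0]
          · rw [hℓ₂ b (hnb x b hx2 hxy hxz h0)]; ring
        rw [this, hg, add_zero] at hlift
        exact hlift
      · simp [hout x hx2]
  rw [h₂, Submodule.mem_bot] at hmem₂
  have hzero : ∀ x, x ∈ V₂ → x ≠ y → x ≠ z → ∀ b, ω x b = 0 := by
    intro x hx hxy hxz b
    rw [← hin x hx hxy hxz b, hmem₂]; rfl
  -- what remains is a stress of the first graph
  have hmem₁ : ω ∈ stressSpace R₁ v w A₁ p ℓ₁ := by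
    refine mem_stressSpace.2 ⟨s1, fun x b hxb hn => ?_, s3, s4, fun x hx => ?_⟩
    · by_cases hR2 : R₂ x b
      · have hne : ¬((x = y ∧ b = z) ∨ (x = z ∧ b = y)) := by
          rintro (⟨rfl, rfl⟩ | ⟨rfl, rfl⟩)
          · exact hn hyz
          · exact hn hzy
        have : ω₂ x b = ω x b := by simp only [ω₂, hxb, if_false]; rw [if_pos ⟨hR2, hne⟩]
        rw [← this, hmem₂]; rfl
      · refine s2 x b hxb fun h => ?_
        rcases hR x b h with h | h
        · exact hn h
        · exact hR2 h
    · have hxy : x ≠ y := by rintro rfl; exact hx hy₁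
      have hxz : x ≠ z := by rintro rfl; exact hx hz₁
      by_cases hx2 : x ∈ V₂
      · simp [hzero x hx2 hxy hxz]
      · have hxA : x ∉ A := fun h => by
          rcases hA h with h | h
          · exact hx h
          · exact hx2 (hAV₂ h)
        rw [← s5 x hxA]
        refine Finset.sum_congr rfl fun b _ => ?_
        by_cases h0 : ω x b = 0
        · simp [h0]
        · rw [hℓ₁ b fun hb2 => ?_]
          by_cases hxb : x = b
          · exact absurd (hxb ▸ hb2) hx2
          · have hRx : R x b := by
              by_contra h
              exact h0 (s2 x b hxb h)
            rcases hR x b hRx with h | h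
            · exact hV b (hV₁ x b h).2 hb2
            · exact absurd (hV₂ x b h).1 hx2
  rw [h₁, Submodule.mem_bot] at hmem₁
  exact hmem₁

end

/-! ### Lifts of disks without stress -/

section

variable {V : Type*} [Fintype V] [DecidableEq V] {K : AbstractSimplicialComplex V}
  {p : V → Fin 3 → ℝ}

theorem IsProper.eq_zero_of_sum_eq_zero {V : Type*} {K : AbstractSimplicialComplex V} {d : ℕ}
    {p : V → Fin d → ℝ} (hp : IsProper K p)
    {s : Finset V} (hs : s ∈ K) (hd : s.card ≤ d) {c : V → ℝ} (hc : ∑ x ∈ s, c x • p x = 0) :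
    ∀ x ∈ s, c x = 0 := by
  have hli : LinearIndependent ℝ (fun x : s => p x) := by
    rw [linearIndependent_iff_card_eq_finrank_span, Set.finrank]
    have := hp s hs hd
    rw [Set.image_eq_range] at this
    simpa using this.symm
  have := Fintype.linearIndependent_iff.1 hli (fun x => c x)
    (by rw [Finset.sum_coe_sort s fun x => c x • p x]; exact hc)
  exact fun x hx => this ⟨x, hx⟩

theorem IsProper.eq_zero_of_pair {V : Type*} [DecidableEq V] {K : AbstractSimplicialComplex V}
    {p : V → Fin 3 → ℝ} (hp : IsProper K p) {x y : V} (h : (oneSkeleton K).Adj x y)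
    (α β : ℝ) (h0 : α • p x + β • p y = 0) : α = 0 ∧ β = 0 := by
  have := hp.eq_zero_of_sum_eq_zero h.2 (by rw [Finset.card_pair h.1]; norm_num)
    (c := fun u => if u = x then α else β)
    (by rw [Finset.sum_pair h.1]; simpa [h.1.symm] using h0)
  have hx := this x (by simp)
  have hy := this y (by simp)
  simp only [if_true] at hx
  rw [if_neg h.1.symm] at hy
  exact ⟨hx, hy⟩

/-- A path each of whose vertices lies in the plane of the previous two stays in one plane. -/
theorem mem_of_straight {V E : Type*} [AddCommGroup E] [Module ℝ E] {p : V → E}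
    (H : Submodule ℝ E) {a q : V} {l : List V} (ha : p a ∈ H) (hq : p q ∈ H)
    (h : ∀ l₁ x y z l₂, a :: q :: l = l₁ ++ x :: y :: z :: l₂ →
      p z ∈ Submodule.span ℝ {p x, p y}) : ∀ x ∈ a :: q :: l, p x ∈ H := by
  induction l generalizing a q with
  | nil =>
    intro x hx
    have : x = a ∨ x = q := by simpa using hx
    rcases this with rfl | rfl <;> assumption
  | cons b l ih =>
    have hb : p b ∈ H := by
      refine Submodule.span_le.2 ?_ (h [] a q b l rfl)
      rintro _ (rfl | rfl) <;> assumption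
    intro x hx
    rcases List.mem_cons.1 hx with rfl | hx
    · exact ha
    · exact ih hq hb (fun l₁ x y z l₂ h' => h (a :: l₁) x y z l₂ (by rw [h']; rfl)) x hx

namespace Disk

variable {f : Finset V → ZMod 2} {v w : V} {l : List V}

/-- Without dividing equators, the boundary of a disk is not straight at some inner vertex of its
path: otherwise it would be contained in the plane of its first two vertices. -/
theorem exists_bend (hp : IsProper K p) (hno : ¬HasDividingEquator K p) (h : Disk K f v w l)
    (hl : 3 ≤ l.length) : ∃ l₁ a q b l₂, l = l₁ ++ a :: q :: b :: l₂ ∧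
      p b ∉ Submodule.span ℝ {p a, p q} := by
  by_contra! hcon
  refine hno ?_
  obtain ⟨a, q, r, rfl⟩ : ∃ a q r, l = a :: q :: r := by
    match l, hl with
    | a :: q :: r, _ => exact ⟨a, q, r, rfl⟩
  have hchain : (a :: q :: r).IsChain (oneSkeleton K).Adj := by
    rw [List.isChain_iff_forall_rel_of_append_cons_cons]
    intro a' b' l₁ l₂ heq
    rw [heq] at h hl
    have hn := h.nodup
    refine (chainEdge_of_boundary_eq_one (h.boundary_consecutive ?_)).adj (by grind)
    by_contra! h0
    rw [h0.1, h0.2] at hl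
    simp at hl
  have hvw : (oneSkeleton K).Adj v w :=
    (chainEdge_of_boundary_eq_one (h.boundary_root hl)).adj h.ne
  have hne : a :: q :: r ≠ [] := by simp
  have hhead : (a :: q :: r).head hne = v := by
    have := h.head
    rw [List.head?_eq_some_head hne] at this
    simpa using this
  have hlast : (a :: q :: r).getLast hne = w := by
    have := h.last
    rw [List.getLast?_eq_some_getLast hne] at this
    simpa using this
  let W := SimpleGraph.Walk.ofSupport (a :: q :: r) hne hchain
  have hadj : (oneSkeleton K).Adj ((a :: q :: r).getLast hne) ((a :: q :: r).head hne) := by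
    rw [hhead, hlast]; exact hvw.symm
  refine ⟨_, SimpleGraph.Walk.cons hadj W, ?_, ?_⟩
  · rw [SimpleGraph.Walk.isCycle_iff_isPath_tail_and_le_length]
    constructor
    · simp only [SimpleGraph.Walk.getVert_cons_succ, SimpleGraph.Walk.tail_cons,
        SimpleGraph.Walk.isPath_copy]
      rw [SimpleGraph.Walk.isPath_def, SimpleGraph.Walk.support_ofSupport]
      exact h.nodup
    · rw [SimpleGraph.Walk.length_cons, SimpleGraph.Walk.length_ofSupport]
      omega
  · have haq : (oneSkeleton K).Adj a q := (List.isChain_cons_cons.1 hchain).1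
    refine ⟨Submodule.span ℝ {p a, p q}, ?_, ?_⟩
    · have := hp {a, q} haq.2 (by rw [Finset.card_pair haq.1]; norm_num)
      rw [Finset.card_pair haq.1] at this
      rwa [Finset.coe_pair, Set.image_pair] at this
    · intro u hu
      refine mem_of_straight _ (Submodule.subset_span (by simp))
        (Submodule.subset_span (by simp)) hcon u ?_
      rw [SimpleGraph.Walk.support_cons, SimpleGraph.Walk.support_ofSupport] at hu
      rcases List.mem_cons.1 hu with rfl | hu
      · exact List.getLast_mem _
      · exact hu

/-- Without dividing equators, some lift `ℓ` of a disk admits no nonzero stress. Induction on the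
number of triangles: choose an inner vertex `q` of the boundary path where the path is not
straight. If there is a chord at `q`, cut along it; otherwise remove the star of `q`. -/
theorem exists_lift (hK : IsTriangulatedTwoSphere K) (hp : IsProper K p)
    (hno : ¬HasDividingEquator K p) (h : Disk K f v w l) :
    ∃ ℓ : V → ℝ, stressSpace (ChainEdge K f) v w {x | x ∈ l} p ℓ = ⊥ := by
  induction hn : ((triangles K).filter fun t => f t = 1).card using Nat.strong_induction_on
    generalizing f v w l with
  | _ n ih =>
  subst hn
  by_cases hl : 3 ≤ l.length
  swap
  -- a path with at most two vertices is the edge `vw` itself, and the disk has no triangles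
  · have hlvw : l = [v, w] := by
      have h1 := h.head
      have h2 := h.last
      have h3 := h.ne
      match l, hl with
      | [], _ => simp at h1
      | [a], _ => simp at h1 h2; exact absurd (h1.symm.trans h2) h3
      | [a, b], _ => simp at h1 h2; rw [h1, h2]
      | a :: b :: c :: r, hl => simp at hl
    subst hlvw
    obtain ⟨t₀, ht₀, h₀⟩ := h.proper
    have hzero : ∀ t ∈ triangles K, f t = 0 := by
      intro t ht
      rw [← h₀]
      refine hK.eq_of_boundary_eq_zero (fun x y hxy => ?_) ht ht₀
      rw [h.boundary_eq x y hxy.1, pathChain_cons_cons]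
      simp [pathChain, CharTwo.add_self_eq_zero]
    refine ⟨0, (Submodule.eq_bot_iff _).2 fun ω hω => ?_⟩
    obtain ⟨-, s2, s3, s4, -⟩ := mem_stressSpace.1 hω
    have hoff : ∀ x y, x ≠ y → ω x y = 0 := by
      refine fun x y hxy => s2 x y hxy ?_
      rintro ⟨t, ht, h1, -⟩
      rw [hzero t ht] at h1
      exact zero_ne_one h1
    ext x y
    by_cases hxy : x = y
    · subst hxy
      by_cases hxv : x = v
      · subst hxv; exact s3.2.1
      by_cases hxw : x = w
      · subst hxw; exact s3.2.2
      have hbal := s4 x hxv hxw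
      rw [Finset.sum_eq_single_of_mem x (Finset.mem_univ x)
        (fun y _ hy => by rw [hoff x y hy.symm, zero_smul])] at hbal
      exact hp.eq_zero_of_sum_eq_zero (K.singleton_mem x) (by simp) (c := fun _ => ω x x)
        (by simpa using hbal) x (by simp)
    · exact hoff x y hxy
  · obtain ⟨l₁, a, q, b, l₂, rfl, hbend⟩ := h.exists_bend hp hno hl
    have hn := h.nodup
    have haq : a ≠ q := by grind
    have hqb : q ≠ b := by grind
    have hab : a ≠ b := by grind
    obtain ⟨hqv, hqw⟩ := h.inner_ne
    -- cutting along a chord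
    have chord : ∀ m₁ y mid z m₂, l₁ ++ a :: q :: b :: l₂ = m₁ ++ y :: (mid ++ z :: m₂) →
        mid ≠ [] → (m₁ ≠ [] ∨ m₂ ≠ []) → ChainEdge K f y z →
        ∃ ℓ : V → ℝ,
          stressSpace (ChainEdge K f) v w {x | x ∈ l₁ ++ a :: q :: b :: l₂} p ℓ = ⊥ := by
      intro m₁ y mid z m₂ heq hmid hne hyz
      rw [heq] at h hn ⊢
      obtain ⟨f₁, f₂, hD₁, hD₂, hsum, hsub⟩ := h.split hK hmid hyz
      have hlen₁ : 3 ≤ (m₁ ++ y :: z :: m₂).length := by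
        rcases hne with h | h <;> have := List.length_pos_iff.2 h <;> simp <;> omega
      have hlen₂ : 3 ≤ (y :: (mid ++ [z])).length := by
        have := List.length_pos_iff.2 hmid
        simp
        omega
      have hdisj : ∀ t ∈ triangles K, f₁ t = 1 → f₂ t = 1 → False := by
        intro t ht h1 h2
        have := hsum t ht
        rw [h1, h2, hsub t ht h2] at this
        exact absurd this (by decide)
      have hsub₁ : ∀ t ∈ triangles K, f₁ t = 1 → f t = 1 := by
        intro t ht h1
        have h2 : f₂ t = 0 := by
          by_contra h2
          exact hdisj t ht h1 (zmod_two_eq_one h2)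
        rw [hsum t ht, h1, h2, add_zero]
      obtain ⟨t₁, ht₁, hft₁, -⟩ := hD₁.exists_of_mem hlen₁ hD₁.head_mem
      obtain ⟨t₂, ht₂, hft₂, -⟩ := hD₂.exists_of_mem hlen₂ hD₂.head_mem
      have hlt₁ : ((triangles K).filter fun t => f₁ t = 1).card <
          ((triangles K).filter fun t => f t = 1).card := by
        refine Finset.card_lt_card ((Finset.ssubset_iff_of_subset fun t ht => ?_).2 ⟨t₂, ?_, ?_⟩)
        · rw [Finset.mem_filter] at ht ⊢
          exact ⟨ht.1, hsub₁ t ht.1 ht.2⟩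
        · rw [Finset.mem_filter]
          exact ⟨ht₂, hsub t₂ ht₂ hft₂⟩
        · rw [Finset.mem_filter]
          exact fun hmem => hdisj t₂ ht₂ hmem.2 hft₂
      have hlt₂ : ((triangles K).filter fun t => f₂ t = 1).card <
          ((triangles K).filter fun t => f t = 1).card := by
        refine Finset.card_lt_card ((Finset.ssubset_iff_of_subset fun t ht => ?_).2 ⟨t₁, ?_, ?_⟩)
        · rw [Finset.mem_filter] at ht ⊢
          exact ⟨ht.1, hsub t ht.1 ht.2⟩
        · rw [Finset.mem_filter]
          exact ⟨ht₁, hsub₁ t₁ ht₁ hft₁⟩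
        · rw [Finset.mem_filter]
          exact fun hmem => hdisj t₁ ht₁ hft₁ hmem.2
      obtain ⟨ℓ₁, hℓ₁⟩ := ih _ hlt₁ hD₁ rfl
      obtain ⟨ℓ₂, hℓ₂⟩ := ih _ hlt₂ hD₂ rfl
      have hyz₁ := chainEdge_of_boundary_eq_one (hD₁.boundary_consecutive hne)
      refine exists_stressSpace_union_eq_bot (R₁ := ChainEdge K f₁) (R₂ := ChainEdge K f₂)
        (y := y) (z := z) (V₁ := {x | ∃ t ∈ triangles K, f₁ t = 1 ∧ x ∈ t})
        (V₂ := {x | ∃ t ∈ triangles K, f₂ t = 1 ∧ x ∈ t}) ?_ (fun _ _ h => h.symm) ?_ ?_ ?_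
        hyz₁ hyz₁.symm ?_ (fun x hx => hD₁.exists_of_mem hlen₁ hx)
        (fun x hx => hD₂.exists_of_mem hlen₂ hx) ?_ ?_ ?_ ?_ hD₁.head_mem hD₁.last_mem
        (hp.eq_zero_of_pair (hyz.adj (by grind))) hℓ₁ hℓ₂
      · rintro x x' ⟨t, ht, h1, hx, hx'⟩
        by_cases h2 : f₂ t = 0
        · left
          refine ⟨t, ht, ?_, hx, hx'⟩
          have := hsum t ht
          rwa [h1, h2, add_zero, eq_comm] at this
        · exact Or.inr ⟨t, ht, zmod_two_eq_one h2, hx, hx'⟩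
      · rintro x x' ⟨t, ht, h1, hx, hx'⟩
        exact ⟨⟨t, ht, h1, hx⟩, t, ht, h1, hx'⟩
      · rintro x x' ⟨t, ht, h1, hx, hx'⟩
        exact ⟨⟨t, ht, h1, hx⟩, t, ht, h1, hx'⟩
      · rintro x ⟨s, hs, hs1, hxs⟩ ⟨t, ht, ht2, hxt⟩
        have hx₁ : x ∈ m₁ ++ y :: z :: m₂ := by
          by_contra hx
          exact hdisj t ht ((hD₁.eq_of_not_mem hK hx ht hs hxt hxs).trans hs1) ht2
        have hx₂ : x ∈ y :: (mid ++ [z]) := by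
          by_contra hx
          exact hdisj s hs hs1 ((hD₂.eq_of_not_mem hK hx hs ht hxs hxt).trans ht2)
        rw [List.nodup_append] at hn
        grind
      · intro x hx
        change x ∈ m₁ ++ y :: (mid ++ z :: m₂) at hx
        change x ∈ m₁ ++ y :: z :: m₂ ∨ x ∈ y :: (mid ++ [z])
        simp only [List.mem_append, List.mem_cons] at hx ⊢
        tauto
      · exact (by simp : y ∈ m₁ ++ y :: z :: m₂)
      · exact (by simp : z ∈ m₁ ++ y :: z :: m₂)
      · exact (by simp : y ∈ y :: (mid ++ [z]))
      · exact (by simp : z ∈ y :: (mid ++ [z]))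
    by_cases hch : ∃ x ∈ l₁ ++ a :: q :: b :: l₂, ChainEdge K f q x ∧ x ≠ a ∧ x ≠ q ∧ x ≠ b
    · obtain ⟨x, hx, hqx, hxa, hxq, hxb⟩ := hch
      have hx' : x ∈ l₁ ∨ x ∈ l₂ := by grind
      rcases hx' with hx' | hx'
      · obtain ⟨m₁, m₂, rfl⟩ := List.append_of_mem hx'
        exact chord m₁ x (m₂ ++ [a]) q (b :: l₂) (by simp) (by simp) (by simp) hqx.symm
      · obtain ⟨m₁, m₂, rfl⟩ := List.append_of_mem hx'
        exact chord (l₁ ++ [a]) q (b :: m₁) x m₂ (by simp) (by simp) (by simp) hqx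
    · push Not at hch
      have hq : ∀ x ∈ l₁ ++ a :: q :: b :: l₂, ChainEdge K f q x → x = a ∨ x = q ∨ x = b := by
        intro x hx hqx
        have := hch x hx hqx
        tauto
      obtain ⟨l', hl', hmem⟩ := h.remove_star hK hq
      have haq1 : boundary K f {a, q} = 1 := h.boundary_consecutive (by simp)
      obtain ⟨t₁, ht₁, hft₁, -, hqt₁⟩ := chainEdge_of_boundary_eq_one haq1
      have hlt : ((triangles K).filter fun t => (if q ∈ t then 0 else f t) = 1).card <
          ((triangles K).filter fun t => f t = 1).card := by
        refine Finset.card_lt_card ((Finset.ssubset_iff_of_subset fun t ht => ?_).2 ⟨t₁, ?_, ?_⟩)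
        · rw [Finset.mem_filter] at ht ⊢
          refine ⟨ht.1, ?_⟩
          by_cases hqt : q ∈ t
          · rw [if_pos hqt] at ht
            exact absurd ht.2 zero_ne_one
          · rw [if_neg hqt] at ht
            exact ht.2
        · rw [Finset.mem_filter]
          exact ⟨ht₁, hft₁⟩
        · rw [Finset.mem_filter, if_pos hqt₁]
          exact fun hmem => zero_ne_one hmem.2
      obtain ⟨ℓ', hℓ'⟩ := ih _ hlt hl' rfl
      have haqK : (oneSkeleton K).Adj a q := (chainEdge_of_boundary_eq_one haq1).adj haq
      obtain ⟨t, ht⟩ := exists_stressSpace_update_eq_bot (R := ChainEdge K f) (q := q) (a := a)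
        (b := b) (A := {x | x ∈ l₁ ++ a :: q :: b :: l₂}) (fun x y h => h.symm) hqv hqw
        (by simp) hmem hab haq hqb.symm
        (by
          intro α β γ h0
          have hγ : γ = 0 := by
            by_contra hγ
            refine hbend ?_
            have : p b = (-(γ⁻¹ * α)) • p a + (-(γ⁻¹ * β)) • p q := by
              have h1 : γ⁻¹ • (α • p a + β • p q + γ • p b) = 0 := by rw [h0, smul_zero]
              simp only [smul_add, smul_smul, inv_mul_cancel₀ hγ, one_smul] at h1
              rw [neg_smul, neg_smul, ← neg_add, eq_neg_iff_add_eq_zero, add_comm, h1]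
            rw [this]
            exact Submodule.mem_span_pair.2 ⟨_, _, rfl⟩
          rw [hγ, zero_smul, add_zero] at h0
          obtain ⟨h1, h2⟩ := hp.eq_zero_of_pair haqK _ _ h0
          exact ⟨h1, h2, hγ⟩)
        (fun x hx hxq hqx => by
          rcases hq x hx hqx with h | h | h
          · exact Or.inl h
          · exact absurd h hxq
          · exact Or.inr h)
        (by
          rintro x y hxq hyq hxy ⟨t, ht, hft, hxt, hyt⟩
          by_cases hqt : q ∈ t
          swap
          · exact Or.inl ⟨t, ht, (if_neg hqt).trans hft, hxt, hyt⟩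
          -- the other triangle at the edge `xy` avoids `q`
          obtain ⟨s₁, hs₁, s₂, hs₂, hne, hx1, hy1, hx2, hy2, hall, hb⟩ :=
            hK.exists_boundary_eq (adj_of_mem_triangle ht hxt hyt hxy)
          obtain ⟨s, hs, hst, hxs, hys, hbs⟩ : ∃ s ∈ triangles K, s ≠ t ∧ x ∈ s ∧ y ∈ s ∧
              boundary K f {x, y} = f t + f s := by
            rcases hall t ht hxt hyt with rfl | rfl
            · exact ⟨s₂, hs₂, hne.symm, hx2, hy2, hb f⟩
            · exact ⟨s₁, hs₁, hne, hx1, hy1, by rw [hb, add_comm]⟩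
          have hqs : q ∉ s := by
            intro hqs
            obtain ⟨u, -, -, hu⟩ := exists_eq_of_mem_triangle hs hxs hys hxy
            obtain ⟨u', -, -, hu'⟩ := exists_eq_of_mem_triangle ht hxt hyt hxy
            have h1 : q = u := by
              rw [hu] at hqs; grind
            have h2 : q = u' := by
              rw [hu'] at hqt; grind
            exact hst (by rw [hu, hu', ← h1, ← h2])
          by_cases hb0 : boundary K f {x, y} = 0
          · rw [hb0, hft] at hbs
            exact Or.inl ⟨s, hs, (if_neg hqs).trans (CharTwo.add_eq_zero.1 hbs.symm).symm, hxs, hys⟩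
          · right
            rw [h.boundary_eq x y hxy] at hb0
            by_cases hp0 : pathChain (l₁ ++ a :: q :: b :: l₂) {x, y} = 0
            · rw [hp0, zero_add] at hb0
              have hvw : ({x, y} : Finset V) = {v, w} := by
                by_contra h'
                exact hb0 (if_neg h')
              rwa [← Finset.coe_inj, Finset.coe_pair, Finset.coe_pair,
                Set.pair_eq_pair_iff] at hvw
            · exfalso
              obtain ⟨n₁, c, d, n₂, hl, hcd⟩ := exists_of_pathChain_ne_zero hp0
              rw [← Finset.coe_inj, Finset.coe_pair, Finset.coe_pair,
                Set.pair_eq_pair_iff] at hcd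
              have hxl : x = a ∨ x = q ∨ x = b := hq x (by
                rw [hl]; rcases hcd with ⟨rfl, rfl⟩ | ⟨rfl, rfl⟩ <;> simp) ⟨t, ht, hft, hqt, hxt⟩
              have hyl : y = a ∨ y = q ∨ y = b := hq y (by
                rw [hl]; rcases hcd with ⟨rfl, rfl⟩ | ⟨rfl, rfl⟩ <;> simp) ⟨t, ht, hft, hqt, hyt⟩
              have hab0 : pathChain (l₁ ++ a :: q :: b :: l₂) {a, b} = 0 := by
                rw [pathChain_append, pathChain_cons_cons, pathChain_cons_cons, if_neg, if_neg,
                  pathChain_eq_zero (x := b) (by simp) (by grind),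
                  pathChain_eq_zero (x := a) (by simp) (by grind)]
                · simp
                · intro h'
                  have : a ∈ ({q, b} : Finset V) := by rw [← h']; simp
                  grind
                · intro h'
                  have : b ∈ ({a, q} : Finset V) := by rw [← h']; simp
                  grind
              refine hp0 ?_
              have : ({x, y} : Finset V) = {a, b} := by
                rcases hxl with h | h | h <;> rcases hyl with h' | h' | h' <;> grind
              rw [this, hab0])
        hℓ'
      exact ⟨_, ht⟩

end Disk

end

/-! ### Self-stresses of the sphere -/

section

variable {V : Type*} [Fintype V] [DecidableEq V] {K : AbstractSimplicialComplex V}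
  {p : V → Fin 3 → ℝ}

theorem IsTriangulatedTwoSphere.exists_triangle (hK : IsTriangulatedTwoSphere K) :
    ∃ v z w, ({v, z, w} : Finset V) ∈ triangles K := by
  obtain ⟨x⟩ := hK.connected.nonempty
  obtain ⟨m, hm, ⟨φ⟩⟩ := hK.link_cycle x
  obtain ⟨y, hy⟩ := φ.symm ⟨0, by omega⟩
  obtain ⟨a, -, -, ha, -⟩ := hK.exists_two_triangles hy
  exact ⟨x, y, a, ha⟩

/-- The complement of a triangle is a disk. -/
theorem IsTriangulatedTwoSphere.disk_compl (hK : IsTriangulatedTwoSphere K) {v z w : V}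
    (h : ({v, z, w} : Finset V) ∈ triangles K) :
    Disk K (1 + Pi.single {v, z, w} 1) v w [v, z, w] where
  head := rfl
  last := rfl
  nodup := by
    have := ne_of_mem_triangles h
    simp [this]
  ne := (ne_of_mem_triangles h).2.1
  boundary_eq x y hxy := by
    have h1 : boundary K 1 {x, y} = 0 := by
      by_cases hK' : ({x, y} : Finset V) ∈ K
      · obtain ⟨t₁, -, t₂, -, -, -, -, -, -, -, hb⟩ := hK.exists_boundary_eq ⟨hxy, hK'⟩
        rw [hb]
        exact CharTwo.add_self_eq_zero _
      · exact boundary_eq_zero_of_not_mem (by simp) hK'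
    rw [boundary_add, h1, boundary_single h hxy, pathChain_cons_cons, pathChain_cons_cons]
    simp only [pathChain]
    ring
  proper := ⟨_, h, by
    rw [Pi.add_apply, Pi.single_eq_same]
    exact CharTwo.add_self_eq_zero _⟩

/-- The self-stresses of the 1-skeleton: symmetric weights `ω` on the edges and vertices with
`∑ y, ω x y • p y = 0` at every vertex `x`. Evaluation at the degree 2 monomials identifies the dual
of `𝒜²` with this space. -/
def selfStress (K : AbstractSimplicialComplex V) (p : V → Fin 3 → ℝ) :
    Submodule ℝ (V → V → ℝ) where
  carrier := {ω | (∀ x y, ω x y = ω y x) ∧ (∀ x y, ({x, y} : Finset V) ∉ K → ω x y = 0) ∧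
    ∀ x, ∑ y, ω x y • p y = 0}
  add_mem' := by
    rintro ω ω' ⟨h1, h2, h3⟩ ⟨h1', h2', h3'⟩
    refine ⟨fun x y => ?_, fun x y hxy => ?_, fun x => ?_⟩
    · simp [h1 x y, h1' x y]
    · simp [h2 x y hxy, h2' x y hxy]
    · simp [add_smul, Finset.sum_add_distrib, h3 x, h3' x]
  zero_mem' := by simp
  smul_mem' := by
    rintro c ω ⟨h1, h2, h3⟩
    refine ⟨fun x y => ?_, fun x y hxy => ?_, fun x => ?_⟩
    · simp [h1 x y]
    · simp [h2 x y hxy]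
    · simp [mul_smul, ← Finset.smul_sum, h3 x]

theorem mem_selfStress {ω : V → V → ℝ} : ω ∈ selfStress K p ↔
    (∀ x y, ω x y = ω y x) ∧ (∀ x y, ({x, y} : Finset V) ∉ K → ω x y = 0) ∧
    ∀ x, ∑ y, ω x y • p y = 0 := Iff.rfl

/-- Without dividing equators, the vertices can be lifted to `ℝ⁴` so that no nonzero self-stress
remains in equilibrium. -/
theorem exists_lift_sphere (hK : IsTriangulatedTwoSphere K) (hp : IsProper K p)
    (hno : ¬HasDividingEquator K p) : ∃ ℓ : V → ℝ, ∀ ω ∈ selfStress K p,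
      (∀ x, ∑ y, ω x y * ℓ y = 0) → ω = 0 := by
  classical
  obtain ⟨v, z, w, ht⟩ := hK.exists_triangle
  have hD := hK.disk_compl ht
  obtain ⟨ℓ, hℓ⟩ := hD.exists_lift hK hp hno
  refine ⟨ℓ, fun ω hω hlift => ?_⟩
  obtain ⟨s1, s2, s3⟩ := mem_selfStress.1 hω
  -- normalize at the root; the weights dropped here vanish by the equilibrium at `v` and `w`
  let ω' : V → V → ℝ := fun x y => if (x = v ∨ x = w) ∧ (y = v ∨ y = w) then 0 else ω x y
  have hrow : ∀ x, x ≠ v → x ≠ w → ω' x = ω x := by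
    intro x hv hw
    ext y
    simp [ω', hv, hw]
  have hmem : ω' ∈ stressSpace (ChainEdge K (1 + Pi.single {v, z, w} 1)) v w
      {x | x ∈ [v, z, w]} p ℓ := by
    refine mem_stressSpace.2 ⟨fun x y => ?_, fun x y hxy hn => ?_, ⟨?_, ?_, ?_⟩,
      fun x hv hw => ?_, fun x hx => ?_⟩
    · simp only [ω', s1 x y, and_comm]
    · have : ω x y = 0 := by
        refine s2 x y fun hxyK => hn ?_
        obtain ⟨t₁, h₁, t₂, h₂, hne, hx1, hy1, hx2, hy2, -, -⟩ :=
          hK.exists_boundary_eq (x := x) (y := y) ⟨hxy, hxyK⟩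
        by_cases h1 : t₁ = {v, z, w}
        · refine ⟨t₂, h₂, ?_, hx2, hy2⟩
          rw [Pi.add_apply, Pi.single_eq_of_ne (h1 ▸ hne.symm)]
          rfl
        · refine ⟨t₁, h₁, ?_, hx1, hy1⟩
          rw [Pi.add_apply, Pi.single_eq_of_ne h1]
          rfl
      simp [ω', this]
    · simp [ω']
    · simp [ω']
    · simp [ω']
    · rw [hrow x hv hw, s3]
    · have hx' : x ≠ v ∧ x ≠ z ∧ x ≠ w := by simpa using hx
      rw [hrow x hx'.1 hx'.2.2, hlift]
  rw [hℓ, Submodule.mem_bot] at hmem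
  have hzero : ∀ x y, ¬((x = v ∨ x = w) ∧ (y = v ∨ y = w)) → ω x y = 0 := by
    intro x y h
    have : ω' x y = ω x y := if_neg h
    rw [← this, hmem]; rfl
  have hvw : (oneSkeleton K).Adj v w :=
    adj_of_mem_triangle ht (by simp) (by simp) (ne_of_mem_triangles ht).2.1
  have hend : ∀ x, ω x v = 0 ∧ ω x w = 0 := by
    intro x
    refine hp.eq_zero_of_pair hvw _ _ ?_
    rw [← s3 x, ← Finset.sum_subset (Finset.subset_univ ({v, w} : Finset V)),
      Finset.sum_pair hvw.1]
    intro y _ hy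
    rw [hzero x y (by simp at hy; tauto), zero_smul]
  ext x y
  by_cases hy : y = v ∨ y = w
  · rcases hy with rfl | rfl
    · exact (hend x).1
    · exact (hend x).2
  · exact hzero x y fun h => hy h.2

theorem IsProper.span_eq_top (hp : IsProper K p) (hK : IsTriangulatedTwoSphere K) :
    Submodule.span ℝ (Set.range p) = ⊤ := by
  obtain ⟨v, z, w, ht⟩ := hK.exists_triangle
  obtain ⟨h1, h2⟩ := mem_triangles.1 ht
  have h3 := hp _ h1 h2.le
  have htop : Submodule.span ℝ (p '' (({v, z, w} : Finset V) : Set V)) = ⊤ :=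
    Submodule.eq_top_of_finrank_eq (h3.trans (by rw [h2]; simp))
  exact top_le_iff.1 (htop ▸ Submodule.span_mono (Set.image_subset_range p _))

/-- The space of self-stresses has dimension at least `f₁ + f₀ - (3 f₀ - 3) = f₀ - 3`: the
equilibrium conditions satisfy three linear relations, the vanishing of the total moment. -/
theorem card_le_finrank_selfStress (hK : IsTriangulatedTwoSphere K) (hp : IsProper K p) :
    Fintype.card V ≤ Module.finrank ℝ (selfStress K p) + 3 := by
  -- weights on the vertices and edges, as symmetric functions of two vertices
  let Φ : ((V → ℝ) × (edges K → ℝ)) →ₗ[ℝ] (V → V → ℝ) :=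
    { toFun := fun c x y => if x = y then c.1 x else
        if h : ({x, y} : Finset V) ∈ edges K then c.2 ⟨_, h⟩ else 0
      map_add' := fun c c' => by
        ext x y
        by_cases hxy : x = y
        · simp [hxy]
        · by_cases h : ({x, y} : Finset V) ∈ edges K <;> simp [hxy, h]
      map_smul' := fun r c => by
        ext x y
        by_cases hxy : x = y
        · simp [hxy]
        · by_cases h : ({x, y} : Finset V) ∈ edges K <;> simp [hxy, h] }
  -- the forces at the vertices
  let B : (V → V → ℝ) →ₗ[ℝ] (V → Fin 3 → ℝ) :=
    { toFun := fun ω x => ∑ y, ω x y • p y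
      map_add' := fun ω ω' => by ext x; simp [add_smul, Finset.sum_add_distrib]
      map_smul' := fun r ω => by
        funext x
        simp [mul_smul, Finset.smul_sum] }
  -- the total moment of a system of forces
  let C : (V → Fin 3 → ℝ) →ₗ[ℝ] (Fin 3 → ℝ) := ∑ x, (crossProduct (p x)) ∘ₗ LinearMap.proj x
  have hC : ∀ u, C u = ∑ x, crossProduct (p x) (u x) := by
    intro u; simp [C]
  have hΦsymm : ∀ c x y, Φ c x y = Φ c y x := by
    intro c x y
    by_cases hxy : x = y
    · rw [hxy]
    · simp only [Φ, LinearMap.coe_mk, AddHom.coe_mk, hxy, Ne.symm hxy, if_false,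
        Finset.pair_comm x y]
  have hCsurj : LinearMap.range C = ⊤ := by
    have hall : ∀ a b : Fin 3 → ℝ, crossProduct a b ∈ LinearMap.range C := by
      intro a b
      have ha : a ∈ Submodule.span ℝ (Set.range p) := by rw [hp.span_eq_top hK]; trivial
      induction ha using Submodule.span_induction with
      | mem a ha =>
        obtain ⟨x, rfl⟩ := ha
        refine ⟨Pi.single x b, ?_⟩
        rw [hC, Finset.sum_eq_single_of_mem x (Finset.mem_univ x)]
        · simp
        · intro y _ hy
          simp [Pi.single_eq_of_ne hy]
      | zero => simp
      | add a a' _ _ h h' =>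
        rw [map_add, LinearMap.add_apply]
        exact add_mem h h'
      | smul r a _ h =>
        rw [map_smul, LinearMap.smul_apply]
        exact Submodule.smul_mem _ _ h
    rw [Submodule.eq_top_iff']
    intro a
    have : a = crossProduct ![0, a 0, 0] ![0, 0, 1] + crossProduct ![0, 0, a 1] ![1, 0, 0] +
        crossProduct ![a 2, 0, 0] ![0, 1, 0] := by
      ext i; fin_cases i <;> simp [cross_apply]
    rw [this]
    exact add_mem (add_mem (hall _ _) (hall _ _)) (hall _ _)
  have hle : LinearMap.range (B ∘ₗ Φ) ≤ LinearMap.ker C := by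
    rintro _ ⟨c, rfl⟩
    rw [LinearMap.mem_ker, hC]
    have hexp : ∑ x, crossProduct (p x) ((B ∘ₗ Φ) c x) =
        ∑ x, ∑ y, Φ c x y • crossProduct (p x) (p y) := by
      refine Finset.sum_congr rfl fun x _ => ?_
      change crossProduct (p x) (∑ y, Φ c x y • p y) = _
      rw [map_sum]
      exact Finset.sum_congr rfl fun y _ => by rw [map_smul]
    have hneg : ∑ x, ∑ y, Φ c x y • crossProduct (p x) (p y) =
        -∑ x, ∑ y, Φ c x y • crossProduct (p x) (p y) := by
      conv_lhs => rw [Finset.sum_comm]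
      rw [← Finset.sum_neg_distrib]
      refine Finset.sum_congr rfl fun x _ => ?_
      rw [← Finset.sum_neg_distrib]
      refine Finset.sum_congr rfl fun y _ => ?_
      rw [hΦsymm c y x, ← cross_anticomm, smul_neg]
    rw [hexp]
    exact self_eq_neg.1 hneg
  have hmem : ∀ c ∈ LinearMap.ker (B ∘ₗ Φ), Φ c ∈ selfStress K p := by
    intro c hc
    refine mem_selfStress.2 ⟨hΦsymm c, fun x y hxy => ?_, fun x => ?_⟩
    · have hne : x ≠ y := by
        rintro rfl
        exact hxy (by rw [Finset.pair_eq_singleton]; exact K.singleton_mem x)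
      have hE : ({x, y} : Finset V) ∉ edges K := fun h => hxy (mem_edges.1 h).1
      simp [Φ, hne, hE]
    · exact congrFun (LinearMap.mem_ker.1 hc) x
  have hinj : Function.Injective (Φ.restrict hmem) := by
    rintro ⟨c, hc⟩ ⟨c', hc'⟩ h
    have h' : Φ c = Φ c' := congrArg Subtype.val h
    refine Subtype.ext (Prod.ext ?_ ?_)
    · ext x
      have := congrFun (congrFun h' x) x
      simpa [Φ] using this
    · ext ⟨s, hs⟩
      obtain ⟨x, y, hxy, rfl⟩ := exists_adj_of_mem_edges hs
      have := congrFun (congrFun h' x) y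
      simpa [Φ, hxy.1, hs] using this
  have h1 := LinearMap.finrank_le_finrank_of_injective hinj
  have h2 := (B ∘ₗ Φ).finrank_range_add_finrank_ker
  have h3 := C.finrank_range_add_finrank_ker
  have h4 := Submodule.finrank_mono hle
  rw [hCsurj, finrank_top] at h3
  have hd1 : Module.finrank ℝ ((V → ℝ) × (edges K → ℝ)) = Fintype.card V + (edges K).card := by
    simp
  have hd2 : Module.finrank ℝ (V → Fin 3 → ℝ) = Fintype.card V * 3 := by
    simp [Module.finrank_pi_fintype]
  rw [hd1] at h2
  rw [hd2, Module.finrank_fin_fun] at h3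
  have := hK.card_edges.1
  omega

end

/-! ### Multiplication by a linear form -/

section

variable {V : Type*} [Fintype V] {K : AbstractSimplicialComplex V}
  {p : V → Fin 3 → ℝ}

theorem toArtinianReduction_eq_zero_iff {f : MvPolynomial V ℝ} :
    toArtinianReduction K p f = 0 ↔
      f ∈ Ideal.span (Set.range (linearForm p)) ⊔ nonfaceIdeal K := by
  have hθ : thetaIdeal K p = (Ideal.span (Set.range (linearForm p))).map
      (Ideal.Quotient.mk (nonfaceIdeal K)) := by
    rw [Ideal.map_span, thetaIdeal, ← Set.range_comp]
    rfl
  rw [← Ideal.mem_quotient_iff_mem_sup, ← hθ]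
  exact Ideal.Quotient.eq_zero_iff_mem

theorem toArtinianReduction_mul_linearForm (f : MvPolynomial V ℝ) (i : Fin 3) :
    toArtinianReduction K p (f * linearForm p i) = 0 :=
  toArtinianReduction_eq_zero_iff.2
    (Ideal.mul_mem_left _ _ (Submodule.mem_sup_left (Ideal.subset_span ⟨i, rfl⟩)))

theorem mem_gradedPiece_one {a : ArtinianReduction K p} :
    a ∈ gradedPiece K p 1 ↔ ∃ α : V → ℝ, a = toArtinianReduction K p (∑ v, C (α v) * X v) := by
  rw [gradedPiece, homogeneousSubmodule_one_eq_span_X]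
  constructor
  · rintro ⟨f, hf, rfl⟩
    obtain ⟨α, rfl⟩ := (Submodule.mem_span_range_iff_exists_fun ℝ).1 hf
    refine ⟨α, ?_⟩
    simp only [smul_eq_C_mul]
    rfl
  · rintro ⟨α, rfl⟩
    refine ⟨_, ?_, rfl⟩
    refine (Submodule.mem_span_range_iff_exists_fun ℝ).2 ⟨α, ?_⟩
    simp only [smul_eq_C_mul]

theorem gradedPiece_two : gradedPiece K p 2 =
    Submodule.span ℝ (Set.range fun e : V × V => toArtinianReduction K p (X e.1 * X e.2)) := by
  rw [gradedPiece, ← homogeneousSubmodule_one_pow, homogeneousSubmodule_one_eq_span_X, pow_two,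
    Submodule.span_mul_span, Submodule.map_span]
  congr 1
  ext a
  constructor
  · rintro ⟨_, ⟨_, ⟨x, rfl⟩, _, ⟨y, rfl⟩, rfl⟩, rfl⟩
    exact ⟨(x, y), rfl⟩
  · rintro ⟨⟨x, y⟩, rfl⟩
    exact ⟨_, ⟨_, ⟨x, rfl⟩, _, ⟨y, rfl⟩, rfl⟩, rfl⟩

/-- The functional on polynomials given by a self-stress `ω`: the pairing of `ω` with the Hessian
at the origin. -/
noncomputable def hessianPairing (ω : V → V → ℝ) : MvPolynomial V ℝ →ₗ[ℝ] ℝ :=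
  ∑ x, ∑ y, ω x y • (lcoeff ℝ 0 ∘ₗ (pderiv x).toLinearMap ∘ₗ (pderiv y).toLinearMap)

theorem hessianPairing_apply (ω : V → V → ℝ) (f : MvPolynomial V ℝ) :
    hessianPairing ω f = ∑ x, ∑ y, ω x y * coeff 0 (pderiv x (pderiv y f)) := by
  simp [hessianPairing]

variable [DecidableEq V]

theorem toArtinianReduction_X_mul_X {x y : V} (h : ({x, y} : Finset V) ∉ K) :
    toArtinianReduction K p (X x * X y) = 0 := by
  have hxy : x ≠ y := by
    rintro rfl
    exact h (by rw [Finset.pair_eq_singleton]; exact K.singleton_mem x)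
  have hmem : (X x * X y : MvPolynomial V ℝ) ∈ nonfaceIdeal K := by
    refine Ideal.subset_span ⟨Finsupp.single x 1 + Finsupp.single y 1, ?_, ?_, ?_⟩
    · exact ⟨x, by simp⟩
    · have : (Finsupp.single x 1 + Finsupp.single y 1 : V →₀ ℕ).support = {x, y} := by
        ext u
        simp only [Finsupp.mem_support_iff, Finsupp.add_apply, Finsupp.single_apply,
          Finset.mem_insert, Finset.mem_singleton]
        grind
      rwa [this]
    · rw [X, X, monomial_mul, one_mul]
  have h0 : Ideal.Quotient.mkₐ ℝ (nonfaceIdeal K) (X x * X y) = 0 :=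
    Ideal.Quotient.eq_zero_iff_mem.2 hmem
  rw [toArtinianReduction, AlgHom.comp_apply, h0, map_zero]

theorem pderiv_linear (α : V → ℝ) (y : V) :
    pderiv y (∑ v, C (α v) * X v : MvPolynomial V ℝ) = C (α y) := by
  simp [pderiv_X, Pi.single_apply]

theorem hessianPairing_mul_linear {ω : V → V → ℝ} (hω : ∀ x y, ω x y = ω y x)
    (h : MvPolynomial V ℝ) (α : V → ℝ) : hessianPairing ω (h * ∑ v, C (α v) * X v) =
      2 * ∑ x, coeff 0 (pderiv x h) * ∑ y, ω x y * α y := by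
  have hterm : ∀ x y, coeff 0 (pderiv x (pderiv y (h * ∑ v, C (α v) * X v))) =
      coeff 0 (pderiv y h) * α x + coeff 0 (pderiv x h) * α y := by
    intro x y
    have h0 : constantCoeff (∑ v, C (α v) * X v : MvPolynomial V ℝ) = 0 := by simp
    rw [pderiv_mul, map_add, pderiv_mul, pderiv_mul, pderiv_linear, pderiv_linear, pderiv_C]
    simp only [← constantCoeff_eq, map_add, map_mul, constantCoeff_C, h0, map_zero]
    ring
  rw [hessianPairing_apply]
  simp only [hterm, mul_add, Finset.sum_add_distrib, two_mul]
  congr 1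
  · rw [Finset.sum_comm]
    refine Finset.sum_congr rfl fun x _ => ?_
    rw [Finset.mul_sum]
    exact Finset.sum_congr rfl fun y _ => by rw [hω y x]; ring
  · refine Finset.sum_congr rfl fun x _ => ?_
    rw [Finset.mul_sum]
    exact Finset.sum_congr rfl fun y _ => by ring

/-- The functional of a self-stress factors through `𝒜`. -/
theorem hessianPairing_eq_zero {ω : V → V → ℝ} (hω : ω ∈ selfStress K p) {f : MvPolynomial V ℝ}
    (hf : toArtinianReduction K p f = 0) : hessianPairing ω f = 0 := by
  obtain ⟨h1, h2, h3⟩ := mem_selfStress.1 hω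
  rw [toArtinianReduction_eq_zero_iff] at hf
  have ideal : ∀ S : Set (MvPolynomial V ℝ), (∀ s ∈ S, ∀ h, hessianPairing ω (h * s) = 0) →
      ∀ g ∈ Ideal.span S, hessianPairing ω g = 0 := by
    intro S hS g hg
    suffices h : ∀ h, hessianPairing ω (h * g) = 0 by simpa using h 1
    refine Submodule.span_induction (p := fun g _ => ∀ h, hessianPairing ω (h * g) = 0)
      hS (by simp) (fun a b _ _ ha hb h => ?_) (fun a b _ hb h => ?_) hg
    · rw [mul_add, map_add, ha, hb, add_zero]
    · rw [smul_eq_mul, ← mul_assoc, hb]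
  obtain ⟨g, hg, g', hg', rfl⟩ := Submodule.mem_sup.1 hf
  rw [map_add, ideal _ ?_ g hg, ideal _ ?_ g' hg', add_zero]
  · rintro _ ⟨a, ha, haK, rfl⟩ h
    rw [hessianPairing_apply]
    refine Finset.sum_eq_zero fun x _ => Finset.sum_eq_zero fun y _ => ?_
    rw [coeff_pderiv, coeff_pderiv, coeff_mul_monomial']
    split_ifs with hle
    · have hsub : a.support ⊆ {x, y} := by
        intro u hu
        have h4 := hle u
        rw [Finsupp.mem_support_iff] at hu
        simp only [Finsupp.add_apply, Finsupp.single_apply, Finsupp.zero_apply] at h4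
        grind
      rw [h2 x y fun h => haK (mem_of_subset h hsub ha), zero_mul]
    · simp
  · rintro _ ⟨i, rfl⟩ h
    rw [linearForm, hessianPairing_mul_linear h1]
    have : ∀ x, ∑ y, ω x y * p y i = 0 := by
      intro x
      have := congrFun (h3 x) i
      simpa using this
    simp [this]

theorem hessianPairing_linear_mul_linear {ω : V → V → ℝ} (hω : ∀ x y, ω x y = ω y x)
    (α β : V → ℝ) : hessianPairing ω ((∑ v, C (α v) * X v) * ∑ v, C (β v) * X v) =
      2 * ∑ x, α x * ∑ y, ω x y * β y := by
  rw [hessianPairing_mul_linear hω]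
  simp only [pderiv_linear, coeff_zero_C]

/-- Without dividing equators, the Lefschetz property holds. For a lift `ℓ` without nonzero stress,
multiplication by `∑ ℓ_v x_v` is onto `𝒜²`, because a functional vanishing on its image is a
stress of the lift. It is injective because the self-stresses, of which there are at least
`f₀ - 3` independent ones, map onto the annihilator of the linear forms `Θ`. -/
theorem hasLefschetzProperty_of_no_dividingEquator (hK : IsTriangulatedTwoSphere K)
    (hp : IsProper K p) (hno : ¬HasDividingEquator K p) : HasLefschetzProperty K p 1 := by
  obtain ⟨ℓ, hℓ⟩ := exists_lift_sphere hK hp hno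
  set π := toArtinianReduction K p
  set L : MvPolynomial V ℝ := ∑ v, C (ℓ v) * X v with hL
  refine ⟨π L, mem_gradedPiece_one.2 ⟨ℓ, rfl⟩, ?_⟩
  have hfun : (fun a => π L ^ (3 - 2 * 1) * a) = fun a => π L * a := by
    ext a; simp
  rw [hfun]
  change Set.BijOn _ (gradedPiece K p 1 : Set (ArtinianReduction K p))
    (gradedPiece K p 2 : Set (ArtinianReduction K p))
  have hmaps : ∀ a ∈ gradedPiece K p 1, π L * a ∈ gradedPiece K p 2 := by
    rintro _ ⟨f, hf, rfl⟩
    refine ⟨L * f, ?_, map_mul π L f⟩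
    have hL1 : L.IsHomogeneous 1 :=
      IsHomogeneous.sum _ _ _ fun v _ => isHomogeneous_C_mul_X _ _
    exact hL1.mul hf
  -- multiplication is injective
  have hker : ∀ a ∈ gradedPiece K p 1, π L * a = 0 → a = 0 := by
    intro a ha h0
    obtain ⟨α, rfl⟩ := mem_gradedPiece_one.1 ha
    let T : (V → ℝ) →ₗ[ℝ] (Fin 3 → ℝ) := Fintype.linearCombination ℝ p
    have hT : ∀ β, T β = ∑ v, β v • p v := fun β => Fintype.linearCombination_apply ℝ p β
    let Λ : selfStress K p →ₗ[ℝ] (V → ℝ) :=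
      { toFun := fun ω x => ∑ y, ω.1 x y * ℓ y
        map_add' := fun ω ω' => by ext x; simp [add_mul, Finset.sum_add_distrib]
        map_smul' := fun r ω => by ext x; simp [mul_assoc, Finset.mul_sum] }
    have hΛ : Function.Injective Λ := by
      rw [← LinearMap.ker_eq_bot, LinearMap.ker_eq_bot']
      intro ω hω
      exact Subtype.ext (hℓ ω.1 ω.2 fun x => congrFun hω x)
    have hle : LinearMap.range Λ ≤ LinearMap.ker T := by
      rintro _ ⟨⟨ω, hω⟩, rfl⟩
      obtain ⟨h1, -, h3⟩ := mem_selfStress.1 hω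
      rw [LinearMap.mem_ker, hT]
      have : ∀ x, Λ ⟨ω, hω⟩ x • p x = ∑ y, ℓ y • ω y x • p x := by
        intro x
        change (∑ y, ω x y * ℓ y) • p x = _
        rw [Finset.sum_smul]
        exact Finset.sum_congr rfl fun y _ => by rw [smul_smul, h1 x y, mul_comm]
      simp only [this]
      rw [Finset.sum_comm]
      simp [← Finset.smul_sum, h3]
    have hTsurj : LinearMap.range T = ⊤ := by
      rw [Fintype.range_linearCombination]
      exact hp.span_eq_top hK
    have hdim := T.finrank_range_add_finrank_ker
    rw [hTsurj, finrank_top, Module.finrank_fin_fun, Module.finrank_fintype_fun_eq_card] at hdim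
    have hZ := card_le_finrank_selfStress hK hp
    have heq : LinearMap.range Λ = LinearMap.ker T := by
      refine Submodule.eq_of_le_of_finrank_le hle ?_
      rw [LinearMap.finrank_range_of_inj hΛ]
      omega
    -- so the coefficient vector is orthogonal to the kernel of `T`
    have horth : Fintype.linearCombination ℝ α ∈ (LinearMap.ker T).dualAnnihilator := by
      rw [Submodule.mem_dualAnnihilator, ← heq]
      rintro _ ⟨⟨ω, hω⟩, rfl⟩
      have h2 := hessianPairing_eq_zero hω (f := (∑ v, C (α v) * X v) * L)
        (by rw [mul_comm]; exact (map_mul π L _).trans h0)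
      rw [hL, hessianPairing_linear_mul_linear (mem_selfStress.1 hω).1] at h2
      rw [Fintype.linearCombination_apply]
      have : ∑ x, α x * ∑ y, ω x y * ℓ y = 0 := by linarith
      rw [← this]
      exact Finset.sum_congr rfl fun x _ => mul_comm _ _
    rw [← LinearMap.range_dualMap_eq_dualAnnihilator_ker] at horth
    obtain ⟨g, hg⟩ := horth
    have hα : ∀ v, α v = ∑ i, g (Pi.single i 1) * p v i := by
      intro v
      have h4 : g (T (Pi.single v 1)) = Fintype.linearCombination ℝ α (Pi.single v 1) := by
        rw [← hg]; rfl
      rw [Fintype.linearCombination_apply_single, Fintype.linearCombination_apply_single,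
        one_smul, one_smul] at h4
      rw [← h4, LinearMap.pi_apply_eq_sum_univ g]
      refine Finset.sum_congr rfl fun i _ => ?_
      rw [smul_eq_mul, mul_comm]
      congr 2
      ext j
      simp [Pi.single_apply, eq_comm]
    have hform : (∑ v, C (α v) * X v : MvPolynomial V ℝ) =
        ∑ i, C (g (Pi.single i 1)) * linearForm p i := by
      simp only [hα, map_sum, map_mul, linearForm, Finset.mul_sum, Finset.sum_mul]
      rw [Finset.sum_comm]
      exact Finset.sum_congr rfl fun i _ => Finset.sum_congr rfl fun v _ => by ring
    change toArtinianReduction K p _ = 0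
    rw [hform, map_sum]
    exact Finset.sum_eq_zero fun i _ => toArtinianReduction_mul_linearForm _ i
  refine ⟨hmaps, fun a ha b hb hab => ?_, fun b hb => ?_⟩
  · refine sub_eq_zero.1 (hker _ (sub_mem ha hb) ?_)
    exact (mul_sub (π L) a b).trans (sub_eq_zero.2 hab)
  -- multiplication is surjective
  · by_contra hb'
    have hb'' : b ∉ (gradedPiece K p 1).map (LinearMap.mulLeft ℝ (π L)) := hb'
    obtain ⟨φ, hφb, hφ⟩ := Submodule.exists_le_ker_of_notMem hb''
    refine hφb ?_
    let ω : V → V → ℝ := fun x y => φ (π (X x * X y))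
    have hsum : ∀ (x : V) (c : V → ℝ),
        ∑ y, ω x y * c y = φ (π (X x * ∑ y, C (c y) * X y)) := by
      intro x c
      rw [Finset.mul_sum, map_sum, map_sum]
      refine Finset.sum_congr rfl fun y _ => ?_
      rw [mul_left_comm, ← smul_eq_C_mul, map_smul, map_smul, smul_eq_mul, mul_comm]
    have hω : ω ∈ selfStress K p := by
      refine mem_selfStress.2 ⟨fun x y => ?_, fun x y hxy => ?_, fun x => ?_⟩
      · simp only [ω, mul_comm]
      · simp only [ω]
        rw [toArtinianReduction_X_mul_X hxy, map_zero]
      · ext i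
        simp only [Finset.sum_apply, Pi.smul_apply, smul_eq_mul, Pi.zero_apply]
        rw [hsum x fun y => p y i]
        change φ (toArtinianReduction K p (X x * linearForm p i)) = 0
        rw [toArtinianReduction_mul_linearForm, map_zero]
    have hω0 := hℓ ω hω fun x => by
      rw [hsum, mul_comm, map_mul]
      refine LinearMap.mem_ker.1 (hφ ⟨π (X x), ⟨X x, isHomogeneous_X _ _, rfl⟩, rfl⟩)
    have hle : gradedPiece K p 2 ≤ LinearMap.ker φ := by
      rw [gradedPiece_two, Submodule.span_le]
      rintro _ ⟨⟨x, y⟩, rfl⟩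
      exact congrFun (congrFun hω0 x) y
    exact hle hb

end

end UnstableBlueprint

theorem mainTheorem1 {V : Type*} [Fintype V] [DecidableEq V] (K : AbstractSimplicialComplex V)
    (p : V → Fin 3 → ℝ) (h : UnstableBlueprint.IsUnstableBlueprint K p) :
    UnstableBlueprint.HasDividingEquator K p := by
  by_contra hno
  exact h.not_lefschetz
    (UnstableBlueprint.hasLefschetzProperty_of_no_dividingEquator h.sphere h.proper hno)
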